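/- Let $G$ be a finite-dimensional real Lie group with Lie algebra $\mathfrak g$, let $\cdot$ be an $\mathrm{Ad}$-invariant, non-degenerate symmetric bilinear form on $\mathfrak g$, and let $\theta^L,\theta^R$ be the Maurer–Cartan forms. Put $\eta=\tfrac1{12}\,\theta^L\cdot[\theta^L,\theta^L]\in\Omega^3(G)$ and $\eta_G(x)=\eta-\tfrac12(\theta^L+\theta^R)\cdot x$ for $x\in\mathfrak g$. Let $A\to G$ be the bundle with fibres $$A_g=\{\xi\in C^\infty(\mathbb R,\mathfrak g)\mid \exists\, v_\xi\in\mathfrak g\ \forall t:\ \xi(t+1)=\mathrm{Ad}_g\xi(t)+v_\xi\},$$ with anchor $\mathsf a\colon A_g\to T_gG$ given by $\theta^R(\mathsf a(\xi))=v_\xi$, and with the 2-form $$\varpi(\xi,\zeta)=\int_0^1\dot\xi\cdot\zeta\,dt-\mathrm{Ad}_g\xi(0)\cdot v_\zeta-\tfrac12 v_\xi\cdot v_\zeta .$$ Let $M$ be a finite-dimensional manifold with a smooth $G$-action, with generating vector fields $x_M(m)=\frac{d}{du}\big|_{u=0}\exp(-ux)\cdot m$ for $x\in\mathfrak g$. For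 an invariant form $\omega$ let $(d_G\omega)(x)=d\omega-\iota(x_M)\omega$. Let $\Phi\colon M\to G$ be smooth and equivariant for the conjugation action on $G$, and let $\omega\in\Omega^2(M)$ be a $G$-invariant 2-form with $d_G\omega=-\Phi^*\eta_G$. Let $\Phi^!A\to M$ be the pull-back Lie algebroid, with fibres $(\Phi^!A)_m=\{(w,\xi)\in T_mM\oplus A_{\Phi(m)}\mid d\Phi(w)=\mathsf a(\xi)\}$, anchor $\mathsf a_M(w,\xi)=w$, and bracket on sections $$[(X,\xi),(Y,\zeta)]=([X,Y],\,-[\xi,\zeta]_{\mathfrak g}+X\zeta-Y\xi).$$ Let $\varpi_M=\Phi^!\varpi$ be the pull-back of $\varpi$ to $\Phi^!A$, and for $x\in\mathfrak g$ let $x_A\equiv-x$ be the constant path. **(a)** For every $m\in M$, the kernel of $\mathsf a_M^*\omega+\varpi_M$ on $(\Phi^!A)_m$ is the direct sum $$\ker(\mathsf a_M^*\omega+\varpi_M)_m=\mathfrak g\oplus\big(\ker\omega_m\cap\ker d_m\Phi\big),$$ where $\mathfrak g$ is embedded by $x\mapsto(x_M(m),x_A)$ and $\ker\omega_m\cap\ker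 d_m\Phi$ is embedded by $v\mapsto(v,0)$. **(b)** Suppose in addition that $\ker\omega_m\cap\ker d_m\Phi=0$ for all $m$, i.e. that $(M,\omega,\Phi)$ is a q-Hamiltonian $G$-space. Then $\ker(\mathsf a_M^*\omega+\varpi_M)$ is the action Lie algebroid $M\times\mathfrak g$, embedded by $(m,x)\mapsto(x_M(m),x_A)$. That is: this map is injective on fibres with image the kernel; the smooth sections of $\Phi^!A$ with values in the kernel are exactly the images of the smooth functions $f\colon M\to\mathfrak g$; and the map on sections is compatible with anchors and brackets, where the action algebroid has anchor $f\mapsto f_M$, $f_M(m)=(f(m))_M(m)$, and bracket $[f,h]=[f,h]_{\mathfrak g}+f_M h-h_M f$. -/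

import Mathlib

open Set MeasureTheory VectorField
open scoped Manifold ContDiff

noncomputable section

namespace PathAlgebroid

/-! ### Lie groups

A finite-dimensional real Lie group `G` is modelled on a normed space `𝔤`.  By Mathlib's conventions
the tangent space `GroupLieAlgebra 𝓘(ℝ, 𝔤) G = T₁G` is then (definitionally) the vector space `𝔤`
itself; we write `𝔤` for it, so as to have a norm at hand, and equip it with Mathlib's Lie bracket
of left-invariant vector fields. -/

section LieGroup

variable {𝔤 : Type*} [NormedAddCommGroup 𝔤] [NormedSpace ℝ 𝔤]
  {G : Type*} [TopologicalSpace G] [ChartedSpace 𝔤 G] [Group G]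

variable (G) in
/-- The Lie bracket on `𝔤 = T₁G`, given by left-invariant vector fields. -/
def lie (x y : 𝔤) : 𝔤 :=
  @Bracket.bracket (GroupLieAlgebra 𝓘(ℝ, 𝔤) G) (GroupLieAlgebra 𝓘(ℝ, 𝔤) G) _ x y

/-- The adjoint action `Ad_g : 𝔤 → 𝔤`, the derivative at `1` of `h ↦ g h g⁻¹`. -/
def Ad (g : G) : 𝔤 →L[ℝ] 𝔤 :=
  mfderiv 𝓘(ℝ, 𝔤) 𝓘(ℝ, 𝔤) (fun h : G => g * h * g⁻¹) 1

/-- The left Maurer-Cartan form `θᴸ_g : T_g G → 𝔤`, `v ↦ g⁻¹ v`. -/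
def thetaL (g : G) : TangentSpace 𝓘(ℝ, 𝔤) g →L[ℝ] 𝔤 :=
  mfderiv 𝓘(ℝ, 𝔤) 𝓘(ℝ, 𝔤) (fun h : G => g⁻¹ * h) g

/-- The right Maurer-Cartan form `θᴿ_g : T_g G → 𝔤`, `v ↦ v g⁻¹`. -/
def thetaR (g : G) : TangentSpace 𝓘(ℝ, 𝔤) g →L[ℝ] 𝔤 :=
  mfderiv 𝓘(ℝ, 𝔤) 𝓘(ℝ, 𝔤) (fun h : G => h * g⁻¹) g

/-- The inverse `𝔤 → T_g G`, `x ↦ x g` of the right trivialization `θᴿ_g`. -/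
def rightTriv (g : G) : 𝔤 →L[ℝ] TangentSpace 𝓘(ℝ, 𝔤) g :=
  mfderiv 𝓘(ℝ, 𝔤) 𝓘(ℝ, 𝔤) (fun h : G => h * g) 1

end LieGroup

/-! ### Differential forms on a manifold -/

section Forms

variable {E : Type*} [NormedAddCommGroup E] [NormedSpace ℝ E]
  {M : Type*} [TopologicalSpace M] [ChartedSpace E M]

variable (E M) in
/-- (Not necessarily smooth) differential `k`-forms on a manifold `M` modelled on `E`. -/
abbrev DForm (k : ℕ) : Type _ := (m : M) → TangentSpace 𝓘(ℝ, E) m [⋀^Fin k]→L[ℝ] ℝ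

/-- The expression of a form in the preferred chart around `m`, i.e. its pull-back under the inverse
of that chart. -/
def chartForm {k : ℕ} (σ : DForm E M k) (m : M) (y : E) : E [⋀^Fin k]→L[ℝ] ℝ :=
  (σ ((extChartAt 𝓘(ℝ, E) m).symm y)).compContinuousLinearMap
    (mfderiv 𝓘(ℝ, E) 𝓘(ℝ, E) (extChartAt 𝓘(ℝ, E) m).symm y)

/-- A form is smooth if its expressions in charts are. -/
def SmoothForm {k : ℕ} (σ : DForm E M k) : Prop :=
  ∀ m : M, ContDiffOn ℝ ∞ (chartForm σ m) (extChartAt 𝓘(ℝ, E) m).target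

/-- The exterior derivative, computed at `m` in the preferred chart around `m`. -/
def extD {k : ℕ} (σ : DForm E M k) : DForm E M (k + 1) := fun m =>
  (extDeriv (chartForm σ m) (extChartAt 𝓘(ℝ, E) m m)).compContinuousLinearMap
    (mfderiv 𝓘(ℝ, E) 𝓘(ℝ, E) (extChartAt 𝓘(ℝ, E) m) m)

/-- The pull-back `f^* σ` of a form. -/
def pullback {E' : Type*} [NormedAddCommGroup E'] [NormedSpace ℝ E']
    {N : Type*} [TopologicalSpace N] [ChartedSpace E' N] {k : ℕ}
    (f : M → N) (σ : DForm E' N k) : DForm E M k := fun m =>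
  (σ (f m)).compContinuousLinearMap (mfderiv 𝓘(ℝ, E) 𝓘(ℝ, E') f m)

/-- The 1-form given by a family of linear functionals. -/
def oneForm (α : (m : M) → TangentSpace 𝓘(ℝ, E) m →L[ℝ] ℝ) : DForm E M 1 := fun m =>
  ContinuousAlternatingMap.ofSubsingleton ℝ (TangentSpace 𝓘(ℝ, E) m) ℝ (0 : Fin 1) (α m)

/-- `σ_m` as a bilinear form on `T_m M`, for a 2-form `σ`. -/
def bilin (σ : DForm E M 2) (m : M) : LinearMap.BilinForm ℝ (TangentSpace 𝓘(ℝ, E) m) :=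
  LinearMap.mk₂ ℝ (fun v w => σ m ![v, w])
    (fun v v' w => (σ m).toAlternatingMap.map_vecCons_add ![w] v v')
    (fun c v w => (σ m).toAlternatingMap.map_vecCons_smul ![w] c v)
    (fun v w w' => by
      have h : ∀ u, ![v, u] = Function.update ![v, 0] 1 u := fun u => by ext i; fin_cases i <;> rfl
      rw [h (w + w'), h w, h w']
      exact (σ m).map_update_add ![v, 0] 1 w w')
    (fun c v w => by
      have h : ∀ u, ![v, u] = Function.update ![v, 0] 1 u := fun u => by ext i; fin_cases i <;> rfl
      rw [h (c • w), h w]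
      exact (σ m).map_update_smul ![v, 0] 1 c w)

/-- The contraction `ι(X) σ = σ(X, ·)` of a 2-form with a vector field. -/
def contract (X : (m : M) → TangentSpace 𝓘(ℝ, E) m) (σ : DForm E M 2) : DForm E M 1 :=
  oneForm fun m => ⟨bilin σ m (X m), by
    refine (σ m).cont.comp (continuous_pi fun i => ?_)
    fin_cases i
    · exact continuous_const
    · exact continuous_id⟩

end Forms

/-! ### Invariant bilinear forms, the Cartan 3-form, equivariant differential -/

section Cartan

variable {𝔤 : Type*} [NormedAddCommGroup 𝔤] [NormedSpace ℝ 𝔤]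
  {G : Type*} [TopologicalSpace G] [ChartedSpace 𝔤 G] [Group G]

variable (G) in
/-- `Ad`-invariance of a bilinear form on `𝔤`. -/
def AdInvariant (B : LinearMap.BilinForm ℝ 𝔤) : Prop :=
  ∀ (g : G) (x y : 𝔤), B (Ad g x) (Ad g y) = B x y

variable (G) in
lemma lie_eq [LieGroup 𝓘(ℝ, 𝔤) ∞ G] [FiniteDimensional ℝ 𝔤] :
    ∃ L : 𝔤 →ₗ[ℝ] 𝔤 →ₗ[ℝ] 𝔤, ∀ x y, lie G x y = L x y := by
  have : LieGroup 𝓘(ℝ, 𝔤) (minSmoothness ℝ 3) G := by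
    rw [minSmoothness_of_isRCLikeNormedField]; infer_instance
  have : CompleteSpace 𝔤 := FiniteDimensional.complete ℝ 𝔤
  refine ⟨LinearMap.mk₂ ℝ (lie G) ?_ ?_ ?_ ?_, fun x y => rfl⟩
  · intro x x' y
    exact add_lie (L := GroupLieAlgebra 𝓘(ℝ, 𝔤) G) (M := GroupLieAlgebra 𝓘(ℝ, 𝔤) G) x x' y
  · intro c x y
    exact smul_lie (R := ℝ) (L := GroupLieAlgebra 𝓘(ℝ, 𝔤) G) (M := GroupLieAlgebra 𝓘(ℝ, 𝔤) G) c x y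
  · intro x y y'
    exact lie_add (L := GroupLieAlgebra 𝓘(ℝ, 𝔤) G) (M := GroupLieAlgebra 𝓘(ℝ, 𝔤) G) x y y'
  · intro c x y
    exact lie_smul (R := ℝ) (L := GroupLieAlgebra 𝓘(ℝ, 𝔤) G) (M := GroupLieAlgebra 𝓘(ℝ, 𝔤) G) c x y

variable [FiniteDimensional ℝ 𝔤] [LieGroup 𝓘(ℝ, 𝔤) ∞ G]

/-- The trilinear form `(u, v, w) ↦ θᴸ(u) · [θᴸ(v), θᴸ(w)]` on `T_g G`. -/
def cartanTri (B : LinearMap.BilinForm ℝ 𝔤) (g : G) :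
    ContinuousMultilinearMap ℝ (fun _ : Fin 3 => TangentSpace 𝓘(ℝ, 𝔤) g) ℝ where
  toFun v := B (thetaL g (v 0)) (lie G (thetaL g (v 1)) (thetaL g (v 2)))
  map_update_add' v i x y := by
    obtain ⟨L, hL⟩ := lie_eq (𝔤 := 𝔤) G
    rename_i inst
    obtain rfl : inst = instDecidableEqFin 3 := Subsingleton.elim _ _
    fin_cases i <;> simp [hL, Function.update]
  map_update_smul' v i c x := by
    obtain ⟨L, hL⟩ := lie_eq (𝔤 := 𝔤) G
    rename_i inst
    obtain rfl : inst = instDecidableEqFin 3 := Subsingleton.elim _ _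
    fin_cases i <;> simp [hL, Function.update]
  cont := by
    obtain ⟨L, hL⟩ := lie_eq (𝔤 := 𝔤) G
    simp only [hL]
    have hB : Continuous fun p : 𝔤 × 𝔤 => B p.1 p.2 :=
      (LinearMap.toContinuousBilinearMap B).continuous₂
    have hL' : Continuous fun p : 𝔤 × 𝔤 => L p.1 p.2 :=
      (LinearMap.toContinuousBilinearMap L).continuous₂
    have h : ∀ i : Fin 3, Continuous fun v : Fin 3 → TangentSpace 𝓘(ℝ, 𝔤) g => thetaL g (v i) :=
      fun i => (thetaL g).continuous.comp (continuous_apply i)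
    exact hB.comp ((h 0).prodMk (hL'.comp ((h 1).prodMk (h 2))))

/-- The Cartan 3-form `η = (1/12) θᴸ · [θᴸ, θᴸ]`.  The product of `𝔤`-valued forms uses the wedge
product, so that `θᴸ · [θᴸ, θᴸ]` is the full antisymmetrization (the signed sum over all
permutations, without factor) of `θᴸ(u) · [θᴸ(v), θᴸ(w)]`. -/
def cartanForm (B : LinearMap.BilinForm ℝ 𝔤) : DForm 𝔤 G 3 := fun g =>
  (1 / 12 : ℝ) • ContinuousMultilinearMap.alternatization (cartanTri B g)

/-- The 1-form `(θᴸ + θᴿ) · x` on `G`. -/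
def thetaDot (B : LinearMap.BilinForm ℝ 𝔤) (x : 𝔤) : DForm 𝔤 G 1 :=
  oneForm fun g => (LinearMap.toContinuousLinearMap (B.flip x)).comp (thetaL g + thetaR g)

/-- The equivariant Cartan 3-form `η_G(x) = η - ½ (θᴸ + θᴿ) · x`, as a map
`𝔤 → Ω³(G) ⊕ Ω¹(G)`. -/
def cartanFormG (B : LinearMap.BilinForm ℝ 𝔤) (x : 𝔤) : DForm 𝔤 G 3 × DForm 𝔤 G 1 :=
  (cartanForm B, -((1 / 2 : ℝ) • thetaDot B x))

end Cartan

section Action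

variable {𝔤 : Type*} [NormedAddCommGroup 𝔤] [NormedSpace ℝ 𝔤]
  {G : Type*} [TopologicalSpace G] [ChartedSpace 𝔤 G] [Group G]
  {E : Type*} [NormedAddCommGroup E] [NormedSpace ℝ E]
  {M : Type*} [TopologicalSpace M] [ChartedSpace E M] [MulAction G M]

variable (G) in
/-- The generating vector fields `x ↦ x_M(m) = d/du|₀ exp(-u x) • m` of an action of `G` on `M`: the
derivative at `1` of `a ↦ a⁻¹ • m`. With this sign, `x ↦ x_M` is a Lie algebra homomorphism. -/
def generator (m : M) : 𝔤 →L[ℝ] TangentSpace 𝓘(ℝ, E) m :=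
  mfderiv 𝓘(ℝ, 𝔤) 𝓘(ℝ, E) (fun a : G => a⁻¹ • m) 1

variable (G) in
/-- Invariance of a form under the action of `G`. -/
def InvariantForm {k : ℕ} (σ : DForm E M k) : Prop :=
  ∀ a : G, pullback (fun m : M => a • m) σ = σ

variable (G) in
/-- The equivariant differential `(d_G σ)(x) = dσ - ι(x_M) σ` of an invariant 2-form, as a map
`𝔤 → Ω³(M) ⊕ Ω¹(M)`. -/
def equivD (σ : DForm E M 2) (x : 𝔤) : DForm E M 3 × DForm E M 1 :=
  (extD σ, -contract (fun m => generator G m x) σ)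

/-- The pull-back of equivariant 3-forms, seen as maps `𝔤 → Ω³ ⊕ Ω¹`. -/
def equivPullback (Φ : M → G) (α : 𝔤 → DForm 𝔤 G 3 × DForm 𝔤 G 1) (x : 𝔤) :
    DForm E M 3 × DForm E M 1 :=
  (pullback Φ (α x).1, pullback Φ (α x).2)

end Action

/-! ### The Atiyah algebroid `A → G` of the path fibration -/

section Atiyah

variable {𝔤 : Type*} [NormedAddCommGroup 𝔤] [NormedSpace ℝ 𝔤]
  {G : Type*} [TopologicalSpace G] [ChartedSpace 𝔤 G] [Group G]

/-- The fibre `A_g`: smooth paths `ξ : ℝ → 𝔤` with `ξ(t+1) = Ad_g ξ(t) + v` for a constant `v`. -/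
def A (g : G) : Submodule ℝ (ℝ → 𝔤) where
  carrier := {ξ | ContDiff ℝ ∞ ξ ∧ ∃ v : 𝔤, ∀ t, ξ (t + 1) = Ad g (ξ t) + v}
  add_mem' := by
    rintro ξ ζ ⟨h, v, hv⟩ ⟨h', v', hv'⟩
    exact ⟨h.add h', v + v', fun t => by simp only [Pi.add_apply, hv, hv', map_add]; abel⟩
  zero_mem' := ⟨contDiff_const, 0, fun t => by simp⟩
  smul_mem' := by
    rintro c ξ ⟨h, v, hv⟩
    exact ⟨h.const_smul c, c • v, fun t => by simp only [Pi.smul_apply, hv, map_smul, smul_add]⟩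

/-- The constant `v_ξ = ξ(1) - Ad_g ξ(0)` of `ξ ∈ A_g` (the formula makes sense for all paths). -/
def vel (g : G) : (ℝ → 𝔤) →ₗ[ℝ] 𝔤 :=
  LinearMap.proj (R := ℝ) (φ := fun _ : ℝ => 𝔤) 1
    - (Ad g).toLinearMap ∘ₗ LinearMap.proj (R := ℝ) (φ := fun _ : ℝ => 𝔤) 0

/-- The anchor `a : A_g → T_g G`, determined by `θᴿ(a(ξ)) = v_ξ`. -/
def anchor (g : G) : (ℝ → 𝔤) →ₗ[ℝ] TangentSpace 𝓘(ℝ, 𝔤) g :=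
  (rightTriv g).toLinearMap ∘ₗ vel g

lemma intervalIntegrable_varpi [FiniteDimensional ℝ 𝔤] (B : LinearMap.BilinForm ℝ 𝔤) {g : G}
    (ξ ζ : A (𝔤 := 𝔤) g) :
    IntervalIntegrable (fun t => B (deriv (ξ : ℝ → 𝔤) t) ((ζ : ℝ → 𝔤) t)) volume 0 1 := by
  have hB : Continuous fun p : 𝔤 × 𝔤 => B p.1 p.2 :=
    (LinearMap.toContinuousBilinearMap B).continuous₂
  exact (hB.comp ((ξ.2.1.continuous_deriv (by simp)).prodMk ζ.2.1.continuous)).intervalIntegrable _ _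

lemma differentiable_path {g : G} (ξ : A (𝔤 := 𝔤) g) : Differentiable ℝ (ξ : ℝ → 𝔤) :=
  ξ.2.1.differentiable (by simp)

/-- The 2-form `ϖ ∈ Γ(∧² A^*)`,
`ϖ(ξ, ζ) = ∫₀¹ ξ̇ · ζ - Ad_g ξ(0) · v_ζ - ½ v_ξ · v_ζ`. -/
def varpi [FiniteDimensional ℝ 𝔤] (B : LinearMap.BilinForm ℝ 𝔤) (g : G) :
    LinearMap.BilinForm ℝ (A (𝔤 := 𝔤) g) :=
  LinearMap.mk₂ ℝ
    (fun ξ ζ => (∫ t in (0 : ℝ)..1, B (deriv (ξ : ℝ → 𝔤) t) ((ζ : ℝ → 𝔤) t))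
      - B (Ad g ((ξ : ℝ → 𝔤) 0)) (vel g ζ) - (1 / 2 : ℝ) * B (vel g ξ) (vel g ζ))
    (fun ξ ξ' ζ => by
      have : ∀ t, deriv (((ξ + ξ' : A (𝔤 := 𝔤) g)) : ℝ → 𝔤) t
          = deriv (ξ : ℝ → 𝔤) t + deriv (ξ' : ℝ → 𝔤) t := fun t =>
        deriv_add (differentiable_path ξ t) (differentiable_path ξ' t)
      simp only [this, map_add, LinearMap.add_apply]
      rw [intervalIntegral.integral_add (intervalIntegrable_varpi B ξ ζ)
        (intervalIntegrable_varpi B ξ' ζ)]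
      simp only [Submodule.coe_add, Pi.add_apply, map_add, LinearMap.add_apply]
      ring)
    (fun c ξ ζ => by
      have : ∀ t, deriv (c • (ξ : ℝ → 𝔤)) t = c • deriv (ξ : ℝ → 𝔤) t := fun t =>
        deriv_const_smul c (differentiable_path ξ t)
      simp only [Submodule.coe_smul, this, map_smul, LinearMap.smul_apply, smul_eq_mul,
        intervalIntegral.integral_const_mul, Pi.smul_apply]
      ring)
    (fun ξ ζ ζ' => by
      simp only [Submodule.coe_add, Pi.add_apply, map_add]
      rw [intervalIntegral.integral_add (intervalIntegrable_varpi B ξ ζ)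
        (intervalIntegrable_varpi B ξ ζ')]
      ring)
    (fun c ξ ζ => by
      simp only [Submodule.coe_smul, Pi.smul_apply, map_smul, smul_eq_mul,
        intervalIntegral.integral_const_mul]
      ring)

end Atiyah

/-! ### The pull-back algebroid `A_M = Φ^! A → M` -/

section Pullback

variable {𝔤 : Type*} [NormedAddCommGroup 𝔤] [NormedSpace ℝ 𝔤]
  {G : Type*} [TopologicalSpace G] [ChartedSpace 𝔤 G] [Group G]
  {E : Type*} [NormedAddCommGroup E] [NormedSpace ℝ E]
  {M : Type*} [TopologicalSpace M] [ChartedSpace E M]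

/-- The fibre of `Φ^! A` at `m`: pairs `(w, ξ) ∈ T_m M ⊕ A_{Φ(m)}` with `dΦ(w) = a(ξ)`. -/
def AM (Φ : M → G) (m : M) : Submodule ℝ (TangentSpace 𝓘(ℝ, E) m × (ℝ → 𝔤)) where
  carrier := {p | p.2 ∈ A (𝔤 := 𝔤) (Φ m) ∧
    mfderiv 𝓘(ℝ, E) 𝓘(ℝ, 𝔤) Φ m p.1 = anchor (Φ m) p.2}
  add_mem' := by
    rintro p q ⟨h, e⟩ ⟨h', e'⟩
    exact ⟨add_mem h h', by simp only [Prod.fst_add, Prod.snd_add, map_add, e, e']⟩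
  zero_mem' := ⟨zero_mem _, by simp only [Prod.fst_zero, Prod.snd_zero, map_zero]⟩
  smul_mem' := by
    rintro c p ⟨h, e⟩
    exact ⟨Submodule.smul_mem _ c h, by simp only [Prod.smul_fst, Prod.smul_snd, map_smul, e]⟩

/-- The anchor `a_M : Φ^! A → TM`, `(w, ξ) ↦ w`. -/
def anchorM (Φ : M → G) (m : M) : AM (𝔤 := 𝔤) (E := E) Φ m →ₗ[ℝ] TangentSpace 𝓘(ℝ, E) m :=
  LinearMap.fst ℝ _ _ ∘ₗ (AM Φ m).subtype

/-- The canonical map `Φ^! A → A`, `(w, ξ) ↦ ξ`. -/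
def toA (Φ : M → G) (m : M) : AM (𝔤 := 𝔤) (E := E) Φ m →ₗ[ℝ] A (𝔤 := 𝔤) (Φ m) :=
  (LinearMap.snd ℝ _ _ ∘ₗ (AM Φ m).subtype).codRestrict _ fun p => p.2.1

/-- The 2-form `a_M^* σ + ϖ_M` on `Φ^! A`, where `ϖ_M = Φ^! ϖ`. -/
def formM [FiniteDimensional ℝ 𝔤] (B : LinearMap.BilinForm ℝ 𝔤) (Φ : M → G) (σ : DForm E M 2)
    (m : M) : LinearMap.BilinForm ℝ (AM (𝔤 := 𝔤) (E := E) Φ m) :=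
  (bilin σ m).compl₁₂ (anchorM Φ m) (anchorM Φ m) + (varpi B (Φ m)).compl₁₂ (toA Φ m) (toA Φ m)

/-- The kernel of `a_M^* σ + ϖ_M` at `m`, viewed inside `T_m M ⊕ C^∞(ℝ, 𝔤)`. -/
def kernelM [FiniteDimensional ℝ 𝔤] (B : LinearMap.BilinForm ℝ 𝔤) (Φ : M → G) (σ : DForm E M 2)
    (m : M) : Submodule ℝ (TangentSpace 𝓘(ℝ, E) m × (ℝ → 𝔤)) :=
  (LinearMap.ker (formM B Φ σ m)).map (AM Φ m).subtype

/-- `ker(σ) ∩ ker(dΦ)` at `m`. -/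
def kerInter (Φ : M → G) (σ : DForm E M 2) (m : M) : Submodule ℝ (TangentSpace 𝓘(ℝ, E) m) :=
  LinearMap.ker (bilin σ m) ⊓ LinearMap.ker (mfderiv 𝓘(ℝ, E) 𝓘(ℝ, 𝔤) Φ m).toLinearMap

variable [MulAction G M]

variable (G) in
/-- The generators of the action on `Φ^! A`: `x ↦ (x_M(m), x_A)`, where `x_A = -x` is a constant
path. -/
def genM (m : M) : 𝔤 →ₗ[ℝ] TangentSpace 𝓘(ℝ, E) m × (ℝ → 𝔤) :=
  (generator G m).toLinearMap.prod (-LinearMap.pi fun _ : ℝ => LinearMap.id)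

/-- The map `𝔤 ⊕ (ker(σ) ∩ ker(dΦ)) → T_m M ⊕ C^∞(ℝ, 𝔤)`, `(x, v) ↦ (x_M(m), x_A) + (v, 0)`. -/
def splitMap (Φ : M → G) (σ : DForm E M 2) (m : M) :
    𝔤 × kerInter (𝔤 := 𝔤) Φ σ m →ₗ[ℝ] TangentSpace 𝓘(ℝ, E) m × (ℝ → 𝔤) :=
  (genM G m).coprod (LinearMap.inl ℝ _ _ ∘ₗ (kerInter Φ σ m).subtype)

/-! ### Sections, brackets, and the action algebroid -/

variable (E M 𝔤) in
/-- A family `m ↦ (X_m, ξ_m)` in `T_m M ⊕ (ℝ → 𝔤)`. -/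
abbrev Fam : Type _ := (m : M) → TangentSpace 𝓘(ℝ, E) m × (ℝ → 𝔤)

/-- The smooth sections of `Φ^! A`: pairs of a smooth vector field `X` on `M` and a smooth function
`ξ` on `M × ℝ` whose value at `m` is in the fibre of `Φ^! A`, for all `m`. -/
def IsSectionAM [IsManifold 𝓘(ℝ, E) ∞ M] (Φ : M → G) (s : Fam 𝔤 E M) : Prop :=
  (∀ m, s m ∈ AM (𝔤 := 𝔤) (E := E) Φ m) ∧
  ContMDiff 𝓘(ℝ, E) (𝓘(ℝ, E).prod 𝓘(ℝ, E)) ∞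
    (fun m => (⟨m, (s m).1⟩ : TangentBundle 𝓘(ℝ, E) M)) ∧
  ContMDiff (𝓘(ℝ, E).prod 𝓘(ℝ, ℝ)) 𝓘(ℝ, 𝔤) ∞ (fun p : M × ℝ => (s p.1).2 p.2)

/-- The derivative `X f` of a `𝔤`-valued function along a vector field. -/
def dirDeriv (X : (m : M) → TangentSpace 𝓘(ℝ, E) m) (f : M → 𝔤) (m : M) : 𝔤 :=
  mfderiv 𝓘(ℝ, E) 𝓘(ℝ, 𝔤) f m (X m)

variable (G) in
/-- The bracket `[(X, ξ), (Y, ζ)] = ([X, Y], -[ξ, ζ] + X ζ - Y ξ)` on sections of `Φ^! A`. -/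
def bracketAM (s s' : Fam 𝔤 E M) : Fam 𝔤 E M := fun m =>
  (mlieBracket 𝓘(ℝ, E) (fun n => (s n).1) (fun n => (s' n).1) m,
    fun t => -lie G ((s m).2 t) ((s' m).2 t)
      + dirDeriv (fun n => (s n).1) (fun n => (s' n).2 t) m
      - dirDeriv (fun n => (s' n).1) (fun n => (s n).2 t) m)

variable (G) in
/-- The anchor of the action algebroid `M × 𝔤`, on sections: `f ↦ (m ↦ f(m)_M(m))`. -/
def actAnchor (f : M → 𝔤) (m : M) : TangentSpace 𝓘(ℝ, E) m := generator G m (f m)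

variable (G E) in
/-- The bracket of the action algebroid `M × 𝔤`, on sections `f, h : M → 𝔤`:
`[f, h]_𝔤 + f_M h - h_M f`. -/
def actBracket (f h : M → 𝔤) (m : M) : 𝔤 :=
  lie G (f m) (h m) + dirDeriv (E := E) (actAnchor G f) h m - dirDeriv (E := E) (actAnchor G h) f m

variable (G E) in
/-- The map `M × 𝔤 → Φ^! A` given by the generators, on sections. -/
def actEmb (f : M → 𝔤) : Fam 𝔤 E M := fun m => genM G m (f m)

end Pullback

end PathAlgebroid

end

open PathAlgebroid

/-! Write a kernel element as (w, ξ). The pairs (0, ζ) with v_ζ = 0 lie in the fibre and do not see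
ω, and on them ϖ(ξ, ζ) is just ∫₀¹ ξ̇·ζ. Bumps supported in (0, 1) are among such ζ, so
non-degeneracy gives ξ̇ = 0 on [0, 1], and quasi-periodicity makes ξ constant on ℝ
(`eq_const_of_integral_eq_zero`).

The generators (x_M, -x) lie in the kernel: on a pair (w, ζ) with dΦ(w) = a(ζ), the moment map
condition says that ω(x_M, w) cancels ϖ(-x, ζ) (`genM_mem_kernelM`). Subtracting the generator with
x = -ξ(0) leaves a kernel element (v, 0). Membership in the fibre gives dΦ(v) = 0, and surjectivity
of the anchor Φ^!A → TM gives v ∈ ker ω (`exists_of_mem_kernelM`).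

For (b), x is read off smoothly as -ξ(0). Compatibility with brackets reduces to [x_M, y_M] = [x,
y]_M and the Leibniz rule. The former holds because a ↦ a⁻¹ • m relates left-invariant fields to
generating fields (`mlieBracket_generator`). -/

namespace PathAlgebroid

open Filter Topology

/-! ### Smooth quasi-periodic extension of paths -/

section Paths

variable {F : Type*} [NormedAddCommGroup F] [NormedSpace ℝ F]

lemma contDiff_perm_zpow {T : Equiv.Perm F} (hT : ContDiff ℝ ∞ T) (hT' : ContDiff ℝ ∞ T.symm)
    (n : ℤ) : ContDiff ℝ ∞ ⇑(T ^ n) := by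
  have key : ∀ (S : Equiv.Perm F), ContDiff ℝ ∞ S → ∀ k : ℕ, ContDiff ℝ ∞ ⇑(S ^ k) := by
    intro S hS k
    induction k with
    | zero => exact contDiff_id
    | succ k ih => rw [pow_succ]; exact ih.comp hS
  rcases n with k | k
  · simpa using key T hT k
  · rw [zpow_negSucc, ← inv_pow]
    exact key T⁻¹ hT' (k + 1)

/-- The quasi-periodic extension of a path on `[0, 1]` which is locally constant at the ends is
smooth. -/
lemma contDiff_quasiPeriodic {T : Equiv.Perm F} (hT : ContDiff ℝ ∞ T) (hT' : ContDiff ℝ ∞ T.symm)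
    {φ : ℝ → F} (hφ : ContDiff ℝ ∞ φ) (h0 : ∀ᶠ t in 𝓝 0, φ t = 0) (h1 : ∀ᶠ t in 𝓝 1, φ t = T 0) :
    ContDiff ℝ ∞ fun t : ℝ => (T ^ ⌊t⌋) (φ (Int.fract t)) := by
  refine contDiff_iff_contDiffAt.2 fun t₀ => ?_
  set n : ℤ := ⌊t₀⌋ with hn
  by_cases ht : (n : ℝ) = t₀
  -- At an integer n the path is locally constant: it is T^n 0 on the right and T^(n-1) (T 0) on the
  -- left.
  · have e0 : ∀ᶠ t in 𝓝 t₀, φ (t - n) = 0 := by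
      have : Tendsto (fun t : ℝ => t - n) (𝓝 t₀) (𝓝 0) := by
        have h : Continuous fun t : ℝ => t - n := by fun_prop
        simpa [ht] using h.tendsto t₀
      exact this.eventually h0
    have e1 : ∀ᶠ t in 𝓝 t₀, φ (t - (n - 1 : ℤ)) = T 0 := by
      have : Tendsto (fun t : ℝ => t - (n - 1 : ℤ)) (𝓝 t₀) (𝓝 1) := by
        have h : Continuous fun t : ℝ => t - (n - 1 : ℤ) := by fun_prop
        simpa [ht] using h.tendsto t₀
      exact this.eventually h1
    have e2 : ∀ᶠ t in 𝓝 t₀, t ∈ Ioo ((n : ℝ) - 1) (n + 1) :=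
      Ioo_mem_nhds (by linarith) (by linarith)
    refine (contDiffAt_const (c := (T ^ n) 0)).congr_of_eventuallyEq ?_
    filter_upwards [e0, e1, e2] with t h0 h1 h2
    rcases le_or_gt (n : ℝ) t with h | h
    · have hf : ⌊t⌋ = n := Int.floor_eq_iff.2 ⟨h, h2.2⟩
      simp only [Int.fract, hf, h0]
    · have hf : ⌊t⌋ = n - 1 := Int.floor_eq_iff.2
        ⟨by push_cast; linarith [h2.1], by push_cast; linarith⟩
      simp only [Int.fract, hf, h1]
      rw [← Equiv.Perm.mul_apply, ← zpow_add_one]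
      simp
  -- Off the integers the floor is locally constant, so only one power of T occurs.
  · have hlt : (n : ℝ) < t₀ := lt_of_le_of_ne (Int.floor_le t₀) ht
    have e2 : ∀ᶠ t in 𝓝 t₀, t ∈ Ioo (n : ℝ) (n + 1) :=
      Ioo_mem_nhds hlt (Int.lt_floor_add_one t₀)
    have : ContDiff ℝ ∞ fun t : ℝ => (T ^ n) (φ (t - n)) :=
      (contDiff_perm_zpow hT hT' n).comp (hφ.comp (contDiff_id.sub contDiff_const))
    refine this.contDiffAt.congr_of_eventuallyEq ?_
    filter_upwards [e2] with t ht
    have hf : ⌊t⌋ = n := Int.floor_eq_iff.2 ⟨ht.1.le, ht.2⟩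
    simp only [Int.fract, hf]

omit [NormedAddCommGroup F] [NormedSpace ℝ F] in
lemma quasiPeriodic_add_one (T : Equiv.Perm F) (φ : ℝ → F) (t : ℝ) :
    (T ^ ⌊t + 1⌋) (φ (Int.fract (t + 1))) = T ((T ^ ⌊t⌋) (φ (Int.fract t))) := by
  rw [Int.floor_add_one, Int.fract_add_one, add_comm, zpow_one_add, Equiv.Perm.mul_apply]

end Paths

/-! ### Chain rule with tangent spaces identified with model spaces -/

section Comp

variable {E : Type*} [NormedAddCommGroup E] [NormedSpace ℝ E]
  {M : Type*} [TopologicalSpace M] [ChartedSpace E M]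
  {E' : Type*} [NormedAddCommGroup E'] [NormedSpace ℝ E']
  {M' : Type*} [TopologicalSpace M'] [ChartedSpace E' M']
  {E'' : Type*} [NormedAddCommGroup E''] [NormedSpace ℝ E'']
  {M'' : Type*} [TopologicalSpace M''] [ChartedSpace E'' M'']

/-- The derivative of a map between manifolds, with tangent spaces identified with the model
spaces. -/
noncomputable def mder (f : M → M') (x : M) : E →L[ℝ] E' := mfderiv 𝓘(ℝ, E) 𝓘(ℝ, E') f x

/-- Taking `y` with a proof of `f x = y` allows base points that agree only up to group identities,
such as `1 * g` and `g`. -/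
lemma mder_comp {g : M' → M''} {f : M → M'} {x : M} {y : M'}
    (hg : MDifferentiableAt 𝓘(ℝ, E') 𝓘(ℝ, E'') g y) (hf : MDifferentiableAt 𝓘(ℝ, E) 𝓘(ℝ, E') f x)
    (h : f x = y) (v : E) :
    mder (fun z => g (f z)) x v
      = mder (E := E') (E' := E'') g y (mder (E := E) (E' := E') f x v) := by
  subst h
  exact DFunLike.congr_fun (mfderiv_comp x hg hf) v

lemma mder_id (x : M) (v : E) : mder (E' := E) (fun y : M => y) x v = v :=
  DFunLike.congr_fun (mfderiv_id (I := 𝓘(ℝ, E)) (x := x)) v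

lemma mder_const (x : M) (c : M') (v : E) : mder (E' := E') (fun _ : M => c) x v = 0 :=
  DFunLike.congr_fun (mfderiv_const (I := 𝓘(ℝ, E)) (I' := 𝓘(ℝ, E')) (x := x) (c := c)) v

end Comp

/-! ### The adjoint action and the fibres of the Atiyah algebroid -/

section Ad

variable {𝔤 : Type*} [NormedAddCommGroup 𝔤] [NormedSpace ℝ 𝔤]
  {G : Type*} [TopologicalSpace G] [ChartedSpace 𝔤 G] [Group G] [LieGroup 𝓘(ℝ, 𝔤) ∞ G]

lemma contMDiff_conj (g : G) : ContMDiff 𝓘(ℝ, 𝔤) 𝓘(ℝ, 𝔤) ∞ fun h : G => g * h * g⁻¹ :=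
  (contMDiff_mul_right (I := 𝓘(ℝ, 𝔤)) (n := ∞) (a := g⁻¹)).comp contMDiff_mul_left

lemma mdifferentiableAt_mul_left' (g h : G) :
    MDifferentiableAt 𝓘(ℝ, 𝔤) 𝓘(ℝ, 𝔤) (fun k : G => g * k) h :=
  (contMDiff_mul_left (I := 𝓘(ℝ, 𝔤)) (n := ∞)).mdifferentiable (by simp) h

lemma mdifferentiableAt_mul_right' (g h : G) :
    MDifferentiableAt 𝓘(ℝ, 𝔤) 𝓘(ℝ, 𝔤) (fun k : G => k * g) h :=
  (contMDiff_mul_right (I := 𝓘(ℝ, 𝔤)) (n := ∞)).mdifferentiable (by simp) h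

/-- Conjugations by g and g⁻¹ are mutually inverse and fix 1, so the chain rule applies there. -/
lemma Ad_inv_apply (g : G) (x : 𝔤) : Ad g⁻¹ (Ad g x) = x := by
  have h1 : MDifferentiableAt 𝓘(ℝ, 𝔤) 𝓘(ℝ, 𝔤) (fun h : G => g⁻¹ * h * g⁻¹⁻¹) 1 :=
    (contMDiff_conj g⁻¹).mdifferentiable (by simp) 1
  have h2 : MDifferentiableAt 𝓘(ℝ, 𝔤) 𝓘(ℝ, 𝔤) (fun h : G => g * h * g⁻¹) 1 :=
    (contMDiff_conj g).mdifferentiable (by simp) 1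
  have := mder_comp h1 h2 (by simp) x
  have e : (fun h : G => g⁻¹ * (g * h * g⁻¹) * g⁻¹⁻¹) = fun h => h := by
    ext h; simp [mul_assoc]
  rw [e, mder_id] at this
  exact this.symm

lemma Ad_apply_inv (g : G) (x : 𝔤) : Ad g (Ad g⁻¹ x) = x := by
  simpa using Ad_inv_apply g⁻¹ x

/-- The affine map `y ↦ Ad_g y + v`. -/
noncomputable def adAffine (g : G) (v : 𝔤) : Equiv.Perm 𝔤 where
  toFun y := Ad g y + v
  invFun y := Ad g⁻¹ (y - v)
  left_inv y := by simp [Ad_inv_apply]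
  right_inv y := by simp [Ad_apply_inv]

/-- A path on `[0, 1]` from `0` to `v` which is constant near the ends extends to an element
of `A_g`. -/
lemma exists_extend_path (g : G) {φ : ℝ → 𝔤} (hφ : ContDiff ℝ ∞ φ) {v : 𝔤}
    (h0 : ∀ᶠ t in 𝓝 0, φ t = 0) (h1 : ∀ᶠ t in 𝓝 1, φ t = v) :
    ∃ ζ ∈ A (𝔤 := 𝔤) g, vel g ζ = v ∧ ∀ t ∈ Ico (0 : ℝ) 1, ζ t = φ t := by
  have e : adAffine g v 0 = v := by simp [adAffine]
  refine ⟨fun t : ℝ => (adAffine g v ^ ⌊t⌋) (φ (Int.fract t)), ⟨?_, v, fun t => ?_⟩, ?_, ?_⟩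
  · refine contDiff_quasiPeriodic ?_ ?_ hφ h0 (by simpa only [e] using h1)
    · exact (Ad g).contDiff.add contDiff_const
    · exact (Ad g⁻¹).contDiff.comp (contDiff_id.sub contDiff_const)
  · exact quasiPeriodic_add_one _ _ _
  · have h00 : φ 0 = 0 := h0.self_of_nhds
    simp [vel, h00, adAffine]
  · intro t ht
    have hf : ⌊t⌋ = 0 := Int.floor_eq_iff.2 ⟨by simpa using ht.1, by simpa using ht.2⟩
    simp [Int.fract, hf]

/-- The anchor of `A` is surjective. -/
lemma exists_vel_eq (g : G) (v : 𝔤) : ∃ ζ ∈ A (𝔤 := 𝔤) g, vel g ζ = v := by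
  -- The rescaling 3t - 1 makes the step vanish for t ≤ 1/3 and equal 1 for t ≥ 2/3, hence locally
  -- constant at both ends.
  obtain ⟨ζ, h, h', -⟩ := exists_extend_path (𝔤 := 𝔤) g
    (φ := fun t => Real.smoothTransition (3 * t - 1) • v) (v := v)
    ((Real.smoothTransition.contDiff.comp (by fun_prop)).smul contDiff_const)
    (by
      filter_upwards [gt_mem_nhds (show (0 : ℝ) < 1 / 3 by norm_num)] with t ht
      rw [Real.smoothTransition.zero_of_nonpos (by linarith), zero_smul])
    (by
      filter_upwards [lt_mem_nhds (show (2 / 3 : ℝ) < 1 by norm_num)] with t ht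
      rw [Real.smoothTransition.one_of_one_le (by linarith), one_smul])
  exact ⟨ζ, h, h'⟩

/-- A path in `A_g` which is constant on `(0, 1)` is constant. -/
lemma eq_const_of_deriv_eq_zero {g : G} {ξ : ℝ → 𝔤} (hξ : ξ ∈ A (𝔤 := 𝔤) g)
    (h : ∀ t ∈ Ioo (0 : ℝ) 1, deriv ξ t = 0) (t : ℝ) : ξ t = ξ 0 := by
  obtain ⟨hs, v, hv⟩ := hξ
  have hd : Differentiable ℝ ξ := hs.differentiable (by simp)
  have h01 : ∀ t ∈ Icc (0 : ℝ) 1, ξ t = ξ 0 := by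
    refine constant_of_derivWithin_zero hd.differentiableOn fun t ht => ?_
    have hc : Continuous (deriv ξ) := hs.continuous_deriv (by simp)
    have : deriv ξ t = 0 := by
      have hcl : IsClosed {t | deriv ξ t = 0} := isClosed_eq hc continuous_const
      have : closure (Ioo (0 : ℝ) 1) ⊆ {t | deriv ξ t = 0} := hcl.closure_subset_iff.2 h
      rw [closure_Ioo zero_ne_one] at this
      exact this ⟨ht.1, ht.2.le⟩
    rw [(hd t).derivWithin (uniqueDiffOn_Icc zero_lt_one t ⟨ht.1, ht.2.le⟩), this]
  -- The value ξ(0) = ξ(1) is a fixed point of y ↦ Ad_g y + v. It therefore propagates to later unit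
  -- intervals, and to earlier ones because Ad_g is injective.
  have hfix : Ad g (ξ 0) + v = ξ 0 := by
    rw [← hv 0, zero_add, h01 1 ⟨zero_le_one, le_rfl⟩]
  have hn : ∀ n : ℕ, (∀ t ∈ Icc (0 : ℝ) 1, ξ (t + n) = ξ 0) ∧
      ∀ t ∈ Icc (0 : ℝ) 1, ξ (t - n) = ξ 0 := by
    intro n
    induction n with
    | zero => simpa using h01
    | succ n ih =>
      refine ⟨fun t ht => ?_, fun t ht => ?_⟩
      · rw [Nat.cast_add_one, ← add_assoc, hv, ih.1 t ht, hfix]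
      · have h1 := hv (t - (n + 1 : ℕ))
        have e : t - ((n + 1 : ℕ) : ℝ) + 1 = t - n := by push_cast; ring
        rw [e, ih.2 t ht, ← hfix] at h1
        have := congrArg (Ad g⁻¹) (add_right_cancel h1)
        rw [Ad_inv_apply, Ad_inv_apply] at this
        exact this.symm
  have ht : Int.fract t ∈ Icc (0 : ℝ) 1 := ⟨Int.fract_nonneg t, (Int.fract_lt_one t).le⟩
  have hdec := Int.fract_add_floor t
  rcases Int.eq_nat_or_neg ⌊t⌋ with ⟨n, hn' | hn'⟩
  · rw [← hdec, hn']; exact_mod_cast (hn n).1 _ ht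
  · rw [← hdec, hn']
    simpa [sub_eq_add_neg] using (hn n).2 _ ht

/-- If `∫₀¹ ξ̇ · ζ` vanishes for all `ζ ∈ A_g` with `v_ζ = 0` supported away from the ends,
then `ξ` is constant. -/
lemma eq_const_of_integral_eq_zero [FiniteDimensional ℝ 𝔤] {B : LinearMap.BilinForm ℝ 𝔤}
    (hB : B.Nondegenerate) {g : G} (ξ : A (𝔤 := 𝔤) g)
    (h : ∀ ζ : A (𝔤 := 𝔤) g, vel g (ζ : ℝ → 𝔤) = 0 → varpi B g ξ ζ = 0) (t : ℝ) :
    (ξ : ℝ → 𝔤) t = (ξ : ℝ → 𝔤) 0 := by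
  refine eq_const_of_deriv_eq_zero ξ.2 (fun t ht => ?_) t
  refine hB.1 _ fun y => ?_
  have hB' : Continuous fun p : 𝔤 × 𝔤 => B p.1 p.2 :=
    (LinearMap.toContinuousBilinearMap B).continuous₂
  have hc : Continuous fun t => B (deriv (ξ : ℝ → 𝔤) t) y :=
    hB'.comp ((ξ.2.1.continuous_deriv (by simp)).prodMk continuous_const)
  -- Fundamental lemma of the calculus of variations: ρ • y, with ρ supported in (0, 1), extends to
  -- some ζ with v_ζ = 0, which removes the boundary terms of ϖ.
  have hae : ∀ᵐ t : ℝ, t ∈ Ioo (0 : ℝ) 1 → B (deriv (ξ : ℝ → 𝔤) t) y = 0 := by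
    refine isOpen_Ioo.ae_eq_zero_of_integral_contDiff_smul_eq_zero
      (hc.locallyIntegrable.locallyIntegrableOn _) fun ρ hρ hρc hρs => ?_
    have hz : ∀ s, s ∉ Ioo (0 : ℝ) 1 → ∀ᶠ t in 𝓝 s, ρ t • y = 0 := by
      intro s hs
      have : ρ =ᶠ[𝓝 s] 0 := notMem_tsupport_iff_eventuallyEq.1 fun hs' => hs (hρs hs')
      filter_upwards [this] with t ht
      simp [ht]
    obtain ⟨ζ, hζ, hv, hζφ⟩ := exists_extend_path (𝔤 := 𝔤) g (φ := fun t => ρ t • y) (v := 0)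
      (hρ.smul contDiff_const) (hz 0 (by simp)) (hz 1 (by simp))
    have key := h ⟨ζ, hζ⟩ hv
    simp only [varpi, LinearMap.mk₂_apply, hv, map_zero, mul_zero, sub_zero] at key
    -- The integral passes from (0, 1] to [0, 1), since ζ is known to equal ρ • y only on the
    -- latter.
    rw [← key, intervalIntegral.integral_of_le zero_le_one, ← integral_Ico_eq_integral_Ioc,
      ← setIntegral_eq_integral_of_forall_compl_eq_zero (s := Ico (0 : ℝ) 1)]
    · refine setIntegral_congr_fun measurableSet_Ico fun t ht => ?_
      simp only [hζφ t ht, map_smul]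
    · intro t ht
      have : t ∉ tsupport ρ := fun h' => ht (Ioo_subset_Ico_self (hρs h'))
      rw [image_eq_zero_of_notMem_tsupport this, zero_smul]
  have := Measure.eqOn_open_of_ae_eq (μ := volume) (f := fun t => B (deriv (ξ : ℝ → 𝔤) t) y)
    (g := fun _ => 0) (U := Ioo (0 : ℝ) 1) ((ae_restrict_iff' measurableSet_Ioo).2 hae) isOpen_Ioo
    hc.continuousOn continuousOn_const
  exact this ht

end Ad

/-! ### Product rule and Maurer–Cartan forms -/

section MaurerCartan

variable {𝔤 : Type*} [NormedAddCommGroup 𝔤] [NormedSpace ℝ 𝔤]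
  {G : Type*} [TopologicalSpace G] [ChartedSpace 𝔤 G] [Group G] [LieGroup 𝓘(ℝ, 𝔤) ∞ G]

/-- The product rule at the identity of a Lie group. -/
lemma mder_mul_apply_one {u v : G → G} (hu : MDifferentiableAt 𝓘(ℝ, 𝔤) 𝓘(ℝ, 𝔤) u 1)
    (hv : MDifferentiableAt 𝓘(ℝ, 𝔤) 𝓘(ℝ, 𝔤) v 1) (hu1 : u 1 = 1) (hv1 : v 1 = 1) (x : 𝔤) :
    mder (fun a => u a * v a) (1 : G) x
      = mder (E' := 𝔤) u (1 : G) x + mder (E' := 𝔤) v (1 : G) x := by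
  have hm : MDifferentiableAt (𝓘(ℝ, 𝔤).prod 𝓘(ℝ, 𝔤)) 𝓘(ℝ, 𝔤) (fun p : G × G => p.1 * p.2)
      ((1 : G), (1 : G)) := (contMDiff_mul 𝓘(ℝ, 𝔤) ∞).mdifferentiable (by simp) _
  have h := mfderiv_comp (x := (1 : G)) (f := fun a => (u a, v a)) (I' := 𝓘(ℝ, 𝔤).prod 𝓘(ℝ, 𝔤))
    (g := fun p : G × G => p.1 * p.2) (I'' := 𝓘(ℝ, 𝔤)) (by rw [hu1, hv1]; exact hm)
    (hu.prodMk hv)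
  refine (DFunLike.congr_fun h x).trans ?_
  rw [mfderiv_prodMk hu hv]
  have key : ∀ g h : G, g = 1 → h = 1 → ∀ p : 𝔤 × 𝔤,
      (mfderiv (𝓘(ℝ, 𝔤).prod 𝓘(ℝ, 𝔤)) 𝓘(ℝ, 𝔤) (fun p : G × G => p.1 * p.2) (g, h)
        : 𝔤 × 𝔤 →L[ℝ] 𝔤) p = p.1 + p.2 := by
    rintro _ _ rfl rfl p
    have e : mder (fun z : G => z * 1) 1 p.1 + mder (fun z : G => 1 * z) 1 p.2 = p.1 + p.2 := by
      simp only [mul_one, one_mul, mder_id]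
    exact (mfderiv_prod_eq_add_apply hm).trans e
  exact key _ _ hu1 hv1 _

lemma mdifferentiableAt_inv (g : G) :
    MDifferentiableAt 𝓘(ℝ, 𝔤) 𝓘(ℝ, 𝔤) (fun a : G => a⁻¹) g :=
  (contMDiff_inv 𝓘(ℝ, 𝔤) ∞).mdifferentiable (by simp) g

/-- Differentiate a⁻¹ * a = 1. -/
lemma mder_inv_apply_one (x : 𝔤) : mder (E' := 𝔤) (fun a : G => a⁻¹) (1 : G) x = -x := by
  have h := mder_mul_apply_one (𝔤 := 𝔤) (G := G) (mdifferentiableAt_inv 1)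
    (v := fun a => a) mdifferentiableAt_id inv_one rfl x
  simp only [inv_mul_cancel] at h
  rw [mder_id, mder_const] at h
  exact eq_neg_of_add_eq_zero_left h.symm

lemma thetaR_rightTriv (g : G) (x : 𝔤) : thetaR g (rightTriv g x) = x := by
  have h := mder_comp (mdifferentiableAt_mul_right' (𝔤 := 𝔤) g⁻¹ g)
    (mdifferentiableAt_mul_right' (𝔤 := 𝔤) g 1) (one_mul g) x
  simp only [mul_inv_cancel_right, mder_id] at h
  exact h.symm

lemma thetaL_rightTriv (g : G) (x : 𝔤) : thetaL g (rightTriv g x) = Ad g⁻¹ x := by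
  have h := mder_comp (mdifferentiableAt_mul_left' (𝔤 := 𝔤) g⁻¹ g)
    (mdifferentiableAt_mul_right' (𝔤 := 𝔤) g 1) (one_mul g) x
  have e : (fun h : G => g⁻¹ * (h * g)) = fun h => g⁻¹ * h * g⁻¹⁻¹ := by
    ext h; simp [mul_assoc]
  rw [e] at h
  exact h.symm

lemma rightTriv_thetaR (g : G) (w : TangentSpace 𝓘(ℝ, 𝔤) g) : rightTriv g (thetaR g w) = w := by
  have h := mder_comp (mdifferentiableAt_mul_right' (𝔤 := 𝔤) g 1)
    (mdifferentiableAt_mul_right' (𝔤 := 𝔤) g⁻¹ g) (mul_inv_cancel g) w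
  simp only [inv_mul_cancel_right] at h
  exact h.symm.trans (mder_id (E := 𝔤) g w)

end MaurerCartan

/-! ### Consequences of equivariance and of the moment map condition -/

section Moment

variable {𝔤 : Type*} [NormedAddCommGroup 𝔤] [NormedSpace ℝ 𝔤]
  {G : Type*} [TopologicalSpace G] [ChartedSpace 𝔤 G] [Group G] [LieGroup 𝓘(ℝ, 𝔤) ∞ G]
  {E : Type*} [NormedAddCommGroup E] [NormedSpace ℝ E]
  {M : Type*} [TopologicalSpace M] [ChartedSpace E M]
  [MulAction G M] [ContMDiffSMul 𝓘(ℝ, 𝔤) 𝓘(ℝ, E) ∞ G M]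

lemma contMDiff_inv_smul_left (m : M) :
    ContMDiff 𝓘(ℝ, 𝔤) 𝓘(ℝ, E) ∞ fun a : G => a⁻¹ • m :=
  (ContMDiffSMul.contMDiff_smul (I := 𝓘(ℝ, 𝔤)) (I' := 𝓘(ℝ, E)) (n := ∞) (G := G) (M := M)).comp
    ((contMDiff_inv 𝓘(ℝ, 𝔤) ∞).prodMk contMDiff_const)

lemma mdifferentiableAt_inv_smul_left (m : M) (a : G) :
    MDifferentiableAt 𝓘(ℝ, 𝔤) 𝓘(ℝ, E) (fun a : G => a⁻¹ • m) a :=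
  (contMDiff_inv_smul_left m).mdifferentiable (by simp) a

/-- The differential of an equivariant map `Φ : M → G` on the generating vector fields. -/
lemma mfderiv_generator {Φ : M → G} (hΦ : ContMDiff 𝓘(ℝ, E) 𝓘(ℝ, 𝔤) ∞ Φ)
    (hΦeq : ∀ (a : G) (m : M), Φ (a • m) = a * Φ m * a⁻¹) (m : M) (x : 𝔤) :
    mder (E := E) (E' := 𝔤) Φ m (generator G m x) = rightTriv (Φ m) (Ad (Φ m) x - x) := by
  have h := mder_comp (hΦ.mdifferentiable (by simp) m)
    (mdifferentiableAt_inv_smul_left (𝔤 := 𝔤) (E := E) m (1 : G)) (by simp) x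
  refine h.symm.trans ?_
  set g := Φ m with hg
  -- With g split off on the right, what remains is a product of two maps fixing 1, whose
  -- derivatives are -x and Ad_g x.
  have e : (fun a : G => Φ (a⁻¹ • m)) = fun a => (a⁻¹ * (g * a * g⁻¹)) * g := by
    ext a; simp [hΦeq, mul_assoc, g]
  have hc : MDifferentiableAt 𝓘(ℝ, 𝔤) 𝓘(ℝ, 𝔤) (fun h : G => g * h * g⁻¹) 1 :=
    (contMDiff_conj g).mdifferentiable (by simp) 1
  have hm : MDifferentiableAt 𝓘(ℝ, 𝔤) 𝓘(ℝ, 𝔤) (fun h : G => h⁻¹ * (g * h * g⁻¹)) 1 :=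
    ((contMDiff_inv 𝓘(ℝ, 𝔤) ∞).mul (contMDiff_conj g)).mdifferentiable (by simp) 1
  have h' := mder_comp (mdifferentiableAt_mul_right' (𝔤 := 𝔤) g 1) hm (by simp) x
  rw [mder_mul_apply_one (mdifferentiableAt_inv 1) hc (by simp) (by simp),
    mder_inv_apply_one, neg_add_eq_sub] at h'
  rw [e]
  exact h'

variable [FiniteDimensional ℝ 𝔤]

omit [ContMDiffSMul 𝓘(ℝ, 𝔤) 𝓘(ℝ, E) ∞ G M] in
/-- The moment map condition `ι(x_M) σ = -½ Φ^* (θᴸ + θᴿ) · x`. -/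
lemma bilin_generator {B : LinearMap.BilinForm ℝ 𝔤} {Φ : M → G} {σ : DForm E M 2}
    (hdσ : equivD (𝔤 := 𝔤) G σ = -equivPullback (𝔤 := 𝔤) Φ (cartanFormG (G := G) B))
    (m : M) (x : 𝔤) (w : TangentSpace 𝓘(ℝ, E) m) :
    bilin σ m (generator G m x) w
      = -(1 / 2 : ℝ) * (B (thetaL (Φ m) (mfderiv 𝓘(ℝ, E) 𝓘(ℝ, 𝔤) Φ m w)) x
        + B (thetaR (Φ m) (mfderiv 𝓘(ℝ, E) 𝓘(ℝ, 𝔤) Φ m w)) x) := by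
  -- This is the 1-form component at x, evaluated on w. The signs in d_G, in η_G and in front of
  -- Φ^*η_G combine to -½.
  have h := congrArg (fun s : DForm E M 1 => s m ![w]) (congrArg Prod.snd (congrFun hdσ x))
  have h1 : bilin σ m (generator G m x) w
      = (contract (fun m => generator G m x) σ : DForm E M 1) m ![w] := rfl
  have h2 : (pullback Φ (thetaDot (G := G) B x) : DForm E M 1) m ![w]
      = B (thetaL (Φ m) (mfderiv 𝓘(ℝ, E) 𝓘(ℝ, 𝔤) Φ m w)
        + thetaR (Φ m) (mfderiv 𝓘(ℝ, E) 𝓘(ℝ, 𝔤) Φ m w)) x := rfl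
  have h3 : -(contract (fun m => generator G m x) σ : DForm E M 1) m ![w]
      = -(-((1 / 2 : ℝ) * (pullback Φ (thetaDot (G := G) B x) : DForm E M 1) m ![w])) := h
  rw [h2, map_add, LinearMap.add_apply] at h3
  rw [h1]
  linarith

end Moment

/-! ### The kernel of the 2-form -/

section Kernel

variable {𝔤 : Type*} [NormedAddCommGroup 𝔤] [NormedSpace ℝ 𝔤] [FiniteDimensional ℝ 𝔤]
  {G : Type*} [TopologicalSpace G] [ChartedSpace 𝔤 G] [Group G] [LieGroup 𝓘(ℝ, 𝔤) ∞ G]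
  {E : Type*} [NormedAddCommGroup E] [NormedSpace ℝ E]
  {M : Type*} [TopologicalSpace M] [ChartedSpace E M]

omit [FiniteDimensional ℝ 𝔤] [LieGroup 𝓘(ℝ, 𝔤) ∞ G] in
lemma const_mem_A (g : G) (x : 𝔤) : (fun _ : ℝ => x) ∈ A (𝔤 := 𝔤) g :=
  ⟨contDiff_const, x - Ad g x, fun _ => by simp⟩

omit [FiniteDimensional ℝ 𝔤] [LieGroup 𝓘(ℝ, 𝔤) ∞ G] in
lemma vel_const (g : G) (x : 𝔤) : vel g (fun _ : ℝ => x) = x - Ad g x := rfl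

omit [LieGroup 𝓘(ℝ, 𝔤) ∞ G] in
-- The integral vanishes, and -Ad_g x·v - ½(x - Ad_g x)·v = -½(x + Ad_g x)·v. This has the shape of
-- ½(θᴸ + θᴿ)·x, as the cancellation with ω requires.
lemma varpi_const (B : LinearMap.BilinForm ℝ 𝔤) (g : G) (x : 𝔤) (ζ : A (𝔤 := 𝔤) g) :
    varpi B g ⟨fun _ => x, const_mem_A g x⟩ ζ
      = -(1 / 2 : ℝ) * (B x (vel g (ζ : ℝ → 𝔤)) + B (Ad g x) (vel g (ζ : ℝ → 𝔤))) := by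
  simp only [varpi, LinearMap.mk₂_apply, deriv_const, map_zero, LinearMap.zero_apply,
    intervalIntegral.integral_zero, vel_const, map_sub, LinearMap.sub_apply]
  ring

omit [LieGroup 𝓘(ℝ, 𝔤) ∞ G] in
lemma formM_apply (B : LinearMap.BilinForm ℝ 𝔤) (Φ : M → G) (σ : DForm E M 2) (m : M)
    (p q : AM (𝔤 := 𝔤) (E := E) Φ m) :
    formM B Φ σ m p q = bilin σ m p.1.1 q.1.1 + varpi B (Φ m) ⟨p.1.2, p.2.1⟩ ⟨q.1.2, q.2.1⟩ := rfl

omit [LieGroup 𝓘(ℝ, 𝔤) ∞ G] in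
lemma mem_kernelM {B : LinearMap.BilinForm ℝ 𝔤} {Φ : M → G} {σ : DForm E M 2} {m : M}
    {p : TangentSpace 𝓘(ℝ, E) m × (ℝ → 𝔤)} :
    p ∈ kernelM B Φ σ m ↔ ∃ hp : p ∈ AM (𝔤 := 𝔤) (E := E) Φ m,
      ∀ q : AM (𝔤 := 𝔤) (E := E) Φ m, formM B Φ σ m ⟨p, hp⟩ q = 0 := by
  constructor
  · rintro ⟨p, hp, rfl⟩
    exact ⟨p.2, fun q => LinearMap.congr_fun (LinearMap.mem_ker.1 hp) q⟩
  · rintro ⟨hp, h⟩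
    exact ⟨⟨p, hp⟩, LinearMap.mem_ker.2 (LinearMap.ext h), rfl⟩

omit [FiniteDimensional ℝ 𝔤] in
/-- The anchor of `Φ^! A` is surjective. -/
lemma exists_mem_AM (Φ : M → G) (m : M) (w : TangentSpace 𝓘(ℝ, E) m) :
    ∃ ζ : ℝ → 𝔤, (w, ζ) ∈ AM (𝔤 := 𝔤) (E := E) Φ m := by
  obtain ⟨ζ, hζ, hv⟩ := exists_vel_eq (Φ m) (thetaR (Φ m) (mfderiv 𝓘(ℝ, E) 𝓘(ℝ, 𝔤) Φ m w))
  refine ⟨ζ, hζ, ?_⟩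
  simp only [anchor, LinearMap.comp_apply, hv]
  exact (rightTriv_thetaR (𝔤 := 𝔤) (Φ m) _).symm

omit [LieGroup 𝓘(ℝ, 𝔤) ∞ G] in
lemma inl_mem_kernelM {B : LinearMap.BilinForm ℝ 𝔤} {Φ : M → G} {σ : DForm E M 2} {m : M}
    {v : TangentSpace 𝓘(ℝ, E) m} (hv : v ∈ kerInter (𝔤 := 𝔤) Φ σ m) :
    (v, (0 : ℝ → 𝔤)) ∈ kernelM B Φ σ m := by
  have hA : (v, (0 : ℝ → 𝔤)) ∈ AM (𝔤 := 𝔤) (E := E) Φ m := by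
    refine ⟨zero_mem _, ?_⟩
    rw [map_zero]
    exact hv.2
  refine mem_kernelM.2 ⟨hA, fun q => ?_⟩
  have h1 : bilin σ m v = 0 := hv.1
  have h2 : (⟨(0 : ℝ → 𝔤), hA.1⟩ : A (𝔤 := 𝔤) (Φ m)) = 0 := rfl
  rw [formM_apply]
  simp only [h1, h2, map_zero, LinearMap.zero_apply, add_zero]

variable [MulAction G M] [ContMDiffSMul 𝓘(ℝ, 𝔤) 𝓘(ℝ, E) ∞ G M]
  {B : LinearMap.BilinForm ℝ 𝔤} {Φ : M → G} {σ : DForm E M 2}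

omit [FiniteDimensional ℝ 𝔤] [LieGroup 𝓘(ℝ, 𝔤) ∞ G] [ContMDiffSMul 𝓘(ℝ, 𝔤) 𝓘(ℝ, E) ∞ G M] in
lemma genM_apply (m : M) (x : 𝔤) :
    genM (E := E) G m x = (generator G m x, fun _ => -x) := rfl

omit [FiniteDimensional ℝ 𝔤] in
-- Both sides of the fibre condition come from Ad_g x - x, which is v_ξ for the constant path ξ =
-- -x.
lemma genM_mem_AM (hΦ : ContMDiff 𝓘(ℝ, E) 𝓘(ℝ, 𝔤) ∞ Φ)
    (hΦeq : ∀ (a : G) (m : M), Φ (a • m) = a * Φ m * a⁻¹) (m : M) (x : 𝔤) :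
    genM G m x ∈ AM (𝔤 := 𝔤) (E := E) Φ m := by
  refine ⟨const_mem_A (Φ m) (-x), (mfderiv_generator hΦ hΦeq m x).trans ?_⟩
  change _ = rightTriv (Φ m) (vel (Φ m) fun _ => -x)
  rw [vel_const, map_neg (Ad (Φ m)), neg_sub_neg]

/-- Against (w, ζ) with v = v_ζ, the ω term is -½(Ad_{g⁻¹} v·x + v·x) and the ϖ term is ½(x·v + Ad_g
x·v). Invariance and symmetry of the form make them cancel. -/
lemma genM_mem_kernelM (hBsymm : B.IsSymm) (hBinv : AdInvariant G B)
    (hΦ : ContMDiff 𝓘(ℝ, E) 𝓘(ℝ, 𝔤) ∞ Φ)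
    (hΦeq : ∀ (a : G) (m : M), Φ (a • m) = a * Φ m * a⁻¹)
    (hdσ : equivD (𝔤 := 𝔤) G σ = -equivPullback (𝔤 := 𝔤) Φ (cartanFormG (G := G) B))
    (m : M) (x : 𝔤) : genM G m x ∈ kernelM B Φ σ m := by
  refine mem_kernelM.2 ⟨genM_mem_AM hΦ hΦeq m x, fun q => ?_⟩
  have hq : mfderiv 𝓘(ℝ, E) 𝓘(ℝ, 𝔤) Φ m q.1.1 = rightTriv (Φ m) (vel (Φ m) q.1.2) := q.2.2
  have e1 := bilin_generator hdσ m x q.1.1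
  rw [hq, thetaL_rightTriv, thetaR_rightTriv] at e1
  have e2 := varpi_const B (Φ m) (-x) ⟨q.1.2, q.2.1⟩
  have e3 : B (Ad (Φ m)⁻¹ (vel (Φ m) q.1.2)) x = B (Ad (Φ m) x) (vel (Φ m) q.1.2) := by
    rw [← hBinv (Φ m), Ad_apply_inv, hBsymm.eq]
  have e4 : B (vel (Φ m) q.1.2) x = B x (vel (Φ m) q.1.2) := hBsymm.eq _ _
  rw [formM_apply]
  refine (congrArg₂ (· + ·) e1 e2).trans ?_
  simp only [e3, e4, map_neg, LinearMap.neg_apply]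
  ring

lemma exists_of_mem_kernelM (hBsymm : B.IsSymm) (hBnondeg : B.Nondegenerate)
    (hBinv : AdInvariant G B) (hΦ : ContMDiff 𝓘(ℝ, E) 𝓘(ℝ, 𝔤) ∞ Φ)
    (hΦeq : ∀ (a : G) (m : M), Φ (a • m) = a * Φ m * a⁻¹)
    (hdσ : equivD (𝔤 := 𝔤) G σ = -equivPullback (𝔤 := 𝔤) Φ (cartanFormG (G := G) B))
    {m : M} {p : TangentSpace 𝓘(ℝ, E) m × (ℝ → 𝔤)} (hp : p ∈ kernelM B Φ σ m) :
    ∃ x : 𝔤, ∃ v ∈ kerInter (𝔤 := 𝔤) Φ σ m, p = genM G m x + (v, 0) := by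
  obtain ⟨hA, hp0⟩ := mem_kernelM.1 hp
  -- Testing against (0, ζ) with v_ζ = 0 isolates ϖ.
  have hconst := eq_const_of_integral_eq_zero hBnondeg ⟨p.2, hA.1⟩ fun ζ hζ => by
    have hq : ((0 : TangentSpace 𝓘(ℝ, E) m), (ζ : ℝ → 𝔤)) ∈ AM (𝔤 := 𝔤) (E := E) Φ m := by
      refine ⟨ζ.2, ?_⟩
      simp only [anchor, LinearMap.comp_apply, hζ, map_zero]
    have := hp0 ⟨_, hq⟩
    rw [formM_apply, map_zero, zero_add] at this
    exact this
  set x : 𝔤 := -p.2 0 with hx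
  have hd : p - genM G m x ∈ kernelM B Φ σ m :=
    sub_mem hp (genM_mem_kernelM hBsymm hBinv hΦ hΦeq hdσ m x)
  have hsnd : (p - genM G m x).2 = 0 := by
    ext t
    simp only [Prod.snd_sub, genM_apply, Pi.sub_apply, Pi.zero_apply, hx, neg_neg]
    exact sub_eq_zero.2 (hconst t)
  obtain ⟨hA', hd0⟩ := mem_kernelM.1 hd
  have hpe : p - genM G m x = ((p - genM G m x).1, 0) := Prod.ext rfl hsnd
  refine ⟨x, (p - genM G m x).1, ⟨?_, ?_⟩, ?_⟩
  · refine LinearMap.mem_ker.2 (LinearMap.ext fun w => ?_)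
    -- Any w lifts to a fibre element (w, ζ). As the remaining path is zero, only σ(v, w) survives.
    obtain ⟨ζ, hζ⟩ := exists_mem_AM (𝔤 := 𝔤) Φ m w
    have h := hd0 ⟨_, hζ⟩
    have h0 : (⟨(p - genM G m x).2, hA'.1⟩ : A (𝔤 := 𝔤) (Φ m)) = 0 := Subtype.ext hsnd
    rw [formM_apply] at h
    simp only [h0, map_zero, LinearMap.zero_apply, add_zero] at h
    exact h
  · have h := hA'.2
    rw [hsnd, map_zero] at h
    exact h
  · rw [← hpe]; abel

omit [FiniteDimensional ℝ 𝔤] [LieGroup 𝓘(ℝ, 𝔤) ∞ G] [ContMDiffSMul 𝓘(ℝ, 𝔤) 𝓘(ℝ, E) ∞ G M] in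
lemma splitMap_apply (m : M) (p : 𝔤 × kerInter (𝔤 := 𝔤) Φ σ m) :
    splitMap Φ σ m p = genM G m p.1 + ((p.2 : TangentSpace 𝓘(ℝ, E) m), 0) := rfl

omit [FiniteDimensional ℝ 𝔤] [LieGroup 𝓘(ℝ, 𝔤) ∞ G] [ContMDiffSMul 𝓘(ℝ, 𝔤) 𝓘(ℝ, E) ∞ G M] in
lemma injective_genM (m : M) :
    Function.Injective (genM G m : 𝔤 →ₗ[ℝ] TangentSpace 𝓘(ℝ, E) m × (ℝ → 𝔤)) := by
  intro x y h
  exact neg_injective (congrFun (congrArg Prod.snd h) 0)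

omit [FiniteDimensional ℝ 𝔤] [LieGroup 𝓘(ℝ, 𝔤) ∞ G] [ContMDiffSMul 𝓘(ℝ, 𝔤) 𝓘(ℝ, E) ∞ G M] in
lemma injective_splitMap (m : M) : Function.Injective (splitMap (𝔤 := 𝔤) Φ σ m) := by
  rintro ⟨x, v⟩ ⟨y, w⟩ h
  simp only [splitMap_apply] at h
  have hxy : x = y := by
    have := congrFun (congrArg Prod.snd h) 0
    simpa [genM_apply] using this
  subst hxy
  have := congrArg Prod.fst (add_left_cancel h)
  exact Prod.ext rfl (Subtype.ext this)

lemma range_splitMap (hBsymm : B.IsSymm) (hBnondeg : B.Nondegenerate)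
    (hBinv : AdInvariant G B) (hΦ : ContMDiff 𝓘(ℝ, E) 𝓘(ℝ, 𝔤) ∞ Φ)
    (hΦeq : ∀ (a : G) (m : M), Φ (a • m) = a * Φ m * a⁻¹)
    (hdσ : equivD (𝔤 := 𝔤) G σ = -equivPullback (𝔤 := 𝔤) Φ (cartanFormG (G := G) B)) (m : M) :
    LinearMap.range (splitMap (𝔤 := 𝔤) Φ σ m) = kernelM B Φ σ m := by
  ext p
  constructor
  · rintro ⟨⟨x, v⟩, rfl⟩
    rw [splitMap_apply]
    exact add_mem (genM_mem_kernelM hBsymm hBinv hΦ hΦeq hdσ m x) (inl_mem_kernelM v.2)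
  · intro hp
    obtain ⟨x, v, hv, rfl⟩ := exists_of_mem_kernelM hBsymm hBnondeg hBinv hΦ hΦeq hdσ hp
    exact ⟨(x, ⟨v, hv⟩), rfl⟩

lemma range_genM (hBsymm : B.IsSymm) (hBnondeg : B.Nondegenerate)
    (hBinv : AdInvariant G B) (hΦ : ContMDiff 𝓘(ℝ, E) 𝓘(ℝ, 𝔤) ∞ Φ)
    (hΦeq : ∀ (a : G) (m : M), Φ (a • m) = a * Φ m * a⁻¹)
    (hdσ : equivD (𝔤 := 𝔤) G σ = -equivPullback (𝔤 := 𝔤) Φ (cartanFormG (G := G) B)) {m : M}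
    (hker : kerInter (𝔤 := 𝔤) Φ σ m = ⊥) :
    LinearMap.range (genM G m) = kernelM B Φ σ m := by
  ext p
  constructor
  · rintro ⟨x, rfl⟩
    exact genM_mem_kernelM hBsymm hBinv hΦ hΦeq hdσ m x
  · intro hp
    obtain ⟨x, v, hv, rfl⟩ := exists_of_mem_kernelM hBsymm hBnondeg hBinv hΦ hΦeq hdσ hp
    rw [hker, Submodule.mem_bot] at hv
    subst hv
    exact ⟨x, (add_zero _).symm⟩

end Kernel

/-! ### Lie brackets of related vector fields -/

section RelatedVectorSpace

variable {E : Type*} [NormedAddCommGroup E] [NormedSpace ℝ E]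
  {E' : Type*} [NormedAddCommGroup E'] [NormedSpace ℝ E']

/-- Lie brackets of related vector fields are related, in vector spaces. -/
lemma fderiv_lieBracket_of_related {f : E → E'} {V V' : E → E} {W W' : E' → E'} {x : E}
    (hf : ContDiffAt ℝ 2 f x) (hV : DifferentiableAt ℝ V x) (hV' : DifferentiableAt ℝ V' x)
    (hW : DifferentiableAt ℝ W (f x)) (hW' : DifferentiableAt ℝ W' (f x))
    (h : ∀ᶠ y in 𝓝 x, fderiv ℝ f y (V y) = W (f y))
    (h' : ∀ᶠ y in 𝓝 x, fderiv ℝ f y (V' y) = W' (f y)) :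
    fderiv ℝ f x (lieBracket ℝ V V' x) = lieBracket ℝ W W' (f x) := by
  have hfd : DifferentiableAt ℝ f x := hf.differentiableAt (by simp)
  -- The second-derivative terms of f cancel by symmetry, and relatedness replaces df(V) and df(V')
  -- by W ∘ f and W' ∘ f.
  rw [fderiv_apply_lieBracket hf (by simp [minSmoothness_of_isRCLikeNormedField]) hV' hV,
    EventuallyEq.fderiv_eq (f := fun y => W (f y)) h,
    EventuallyEq.fderiv_eq (f := fun y => W' (f y)) h',
    lieBracket_eq]
  have e : fderiv ℝ (fun y => W (f y)) x = (fderiv ℝ W (f x)).comp (fderiv ℝ f x) :=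
    fderiv_comp x hW hfd
  have e' : fderiv ℝ (fun y => W' (f y)) x = (fderiv ℝ W' (f x)).comp (fderiv ℝ f x) :=
    fderiv_comp x hW' hfd
  rw [e, e', ContinuousLinearMap.comp_apply, ContinuousLinearMap.comp_apply, h.self_of_nhds,
    h'.self_of_nhds]

end RelatedVectorSpace

section Related

variable {E : Type*} [NormedAddCommGroup E] [NormedSpace ℝ E]
  {M : Type*} [TopologicalSpace M] [ChartedSpace E M]

/-- The expression of a vector field in the preferred chart at `x₀`. -/
noncomputable def chartField (V : (x : M) → TangentSpace 𝓘(ℝ, E) x) (x₀ : M) : E → E :=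
  mpullbackWithin 𝓘(ℝ, E) 𝓘(ℝ, E) (extChartAt 𝓘(ℝ, E) x₀).symm V (range 𝓘(ℝ, E))

variable [IsManifold 𝓘(ℝ, E) ∞ M]

lemma mder_extChartAt_symm_mder {x₀ x : M} (hx : x ∈ (extChartAt 𝓘(ℝ, E) x₀).source) (v : E) :
    mder (E := E) (E' := E) (extChartAt 𝓘(ℝ, E) x₀).symm (extChartAt 𝓘(ℝ, E) x₀ x)
      (mder (E := E) (E' := E) (extChartAt 𝓘(ℝ, E) x₀) x v) = v := by
  have h := mfderivWithin_extChartAt_symm_comp_mfderiv_extChartAt' hx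
  rw [ModelWithCorners.range_eq_univ, mfderivWithin_univ] at h
  exact DFunLike.congr_fun h v

lemma mder_extChartAt_mder_symm {x₀ x : M} (hx : x ∈ (extChartAt 𝓘(ℝ, E) x₀).source) (v : E) :
    mder (E := E) (E' := E) (extChartAt 𝓘(ℝ, E) x₀) x
      (mder (E := E) (E' := E) (extChartAt 𝓘(ℝ, E) x₀).symm (extChartAt 𝓘(ℝ, E) x₀ x) v) = v := by
  have h := mfderiv_extChartAt_comp_mfderivWithin_extChartAt_symm' hx
  rw [ModelWithCorners.range_eq_univ, mfderivWithin_univ] at h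
  exact DFunLike.congr_fun h v

lemma mder_symm_chartField (V : (x : M) → TangentSpace 𝓘(ℝ, E) x) {x₀ : M} {y : E}
    (hy : y ∈ (extChartAt 𝓘(ℝ, E) x₀).target) :
    mder (E := E) (E' := E) (extChartAt 𝓘(ℝ, E) x₀).symm y (chartField V x₀ y)
      = V ((extChartAt 𝓘(ℝ, E) x₀).symm y) := by
  have h := isInvertible_mfderivWithin_extChartAt_symm (I := 𝓘(ℝ, E)) hy
  have h2 := DFunLike.congr_fun h.self_comp_inverse (V ((extChartAt 𝓘(ℝ, E) x₀).symm y))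
  have e : mder (E := E) (E' := E) (extChartAt 𝓘(ℝ, E) x₀).symm y
      = mfderivWithin 𝓘(ℝ, E) 𝓘(ℝ, E) (extChartAt 𝓘(ℝ, E) x₀).symm (range 𝓘(ℝ, E)) y := by
    rw [ModelWithCorners.range_eq_univ, mfderivWithin_univ]; rfl
  exact (DFunLike.congr_fun e _).trans h2

lemma chartField_extChartAt (V : (x : M) → TangentSpace 𝓘(ℝ, E) x) {x₀ x : M}
    (hx : x ∈ (extChartAt 𝓘(ℝ, E) x₀).source) :
    chartField V x₀ (extChartAt 𝓘(ℝ, E) x₀ x)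
      = mder (E := E) (E' := E) (extChartAt 𝓘(ℝ, E) x₀) x (V x) := by
  have h := mder_symm_chartField V ((extChartAt 𝓘(ℝ, E) x₀).map_source hx)
  have e : (V ((extChartAt 𝓘(ℝ, E) x₀).symm (extChartAt 𝓘(ℝ, E) x₀ x)) : E) = V x := by
    rw [(extChartAt 𝓘(ℝ, E) x₀).left_inv hx]
  have h2 := h.trans e
  rw [← mder_extChartAt_mder_symm hx (chartField V x₀ (extChartAt 𝓘(ℝ, E) x₀ x)), h2]

lemma differentiableAt_chartField [CompleteSpace E] {V : (x : M) → TangentSpace 𝓘(ℝ, E) x} {x₀ : M}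
    (hV : MDifferentiableAt 𝓘(ℝ, E) (𝓘(ℝ, E).prod 𝓘(ℝ, E))
      (fun x => (⟨x, V x⟩ : TangentBundle 𝓘(ℝ, E) M)) x₀) :
    DifferentiableAt ℝ (chartField V x₀) (extChartAt 𝓘(ℝ, E) x₀ x₀) := by
  have := MDifferentiableWithinAt.differentiableWithinAt_mpullbackWithin_vectorField
    (mdifferentiableWithinAt_univ.2 hV)
  have hu : (extChartAt 𝓘(ℝ, E) x₀).symm ⁻¹' univ ∩ range 𝓘(ℝ, E) = univ := by simp
  rw [hu] at this
  exact differentiableWithinAt_univ.1 this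

/-- The manifold bracket is defined through the inverse of dφ, for φ the chart. Rewriting that
inverse as the derivative of φ⁻¹ makes the chain rule available. -/
lemma mlieBracket_eq_mder_symm (V W : (x : M) → TangentSpace 𝓘(ℝ, E) x) (x₀ : M) :
    mlieBracket 𝓘(ℝ, E) V W x₀
      = mder (E := E) (E' := E) (extChartAt 𝓘(ℝ, E) x₀).symm (extChartAt 𝓘(ℝ, E) x₀ x₀)
      (lieBracket ℝ (chartField V x₀) (chartField W x₀) (extChartAt 𝓘(ℝ, E) x₀ x₀)) := by
  have h : mlieBracket 𝓘(ℝ, E) V W x₀ = (mfderiv 𝓘(ℝ, E) 𝓘(ℝ, E) (extChartAt 𝓘(ℝ, E) x₀) x₀).inverse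
      (lieBracketWithin (E := E) ℝ (chartField V x₀) (chartField W x₀)
        ((extChartAt 𝓘(ℝ, E) x₀).symm ⁻¹' univ ∩ range 𝓘(ℝ, E)) (extChartAt 𝓘(ℝ, E) x₀ x₀)) := rfl
  rw [preimage_univ, ModelWithCorners.range_eq_univ, univ_inter, lieBracketWithin_univ] at h
  have hi := isInvertible_mfderiv_extChartAt (I := 𝓘(ℝ, E)) (mem_extChartAt_source x₀)
  set b := lieBracket ℝ (chartField V x₀) (chartField W x₀) (extChartAt 𝓘(ℝ, E) x₀ x₀)
  have h2 : mder (E := E) (E' := E) (extChartAt 𝓘(ℝ, E) x₀) x₀ (mlieBracket 𝓘(ℝ, E) V W x₀)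
      = b := by
    rw [h]
    exact DFunLike.congr_fun hi.self_comp_inverse b
  rw [← h2]
  exact (mder_extChartAt_symm_mder (E := E) (mem_extChartAt_source (I := 𝓘(ℝ, E)) x₀) _).symm

variable {E' : Type*} [NormedAddCommGroup E'] [NormedSpace ℝ E'] [CompleteSpace E]
  [CompleteSpace E']
  {N : Type*} [TopologicalSpace N] [ChartedSpace E' N] [IsManifold 𝓘(ℝ, E') ∞ N]

/-- Lie brackets of related vector fields are related. -/
lemma mder_mlieBracket_of_related {f : M → N} (hf : ContMDiff 𝓘(ℝ, E) 𝓘(ℝ, E') ∞ f)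
    {V V' : (x : M) → TangentSpace 𝓘(ℝ, E) x} {W W' : (x : N) → TangentSpace 𝓘(ℝ, E') x} {x : M}
    {y : N} (hxy : f x = y)
    (hV : MDifferentiableAt 𝓘(ℝ, E) (𝓘(ℝ, E).prod 𝓘(ℝ, E))
      (fun x => (⟨x, V x⟩ : TangentBundle 𝓘(ℝ, E) M)) x)
    (hV' : MDifferentiableAt 𝓘(ℝ, E) (𝓘(ℝ, E).prod 𝓘(ℝ, E))
      (fun x => (⟨x, V' x⟩ : TangentBundle 𝓘(ℝ, E) M)) x)
    (hW : MDifferentiableAt 𝓘(ℝ, E') (𝓘(ℝ, E').prod 𝓘(ℝ, E'))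
      (fun x => (⟨x, W x⟩ : TangentBundle 𝓘(ℝ, E') N)) y)
    (hW' : MDifferentiableAt 𝓘(ℝ, E') (𝓘(ℝ, E').prod 𝓘(ℝ, E'))
      (fun x => (⟨x, W' x⟩ : TangentBundle 𝓘(ℝ, E') N)) y)
    (h : ∀ z, mder (E := E) (E' := E') f z (V z) = W (f z))
    (h' : ∀ z, mder (E := E) (E' := E') f z (V' z) = W' (f z)) :
    mder (E := E) (E' := E') f x (mlieBracket 𝓘(ℝ, E) V V' x) = mlieBracket 𝓘(ℝ, E') W W' y := by
  subst hxy
  set φ := extChartAt 𝓘(ℝ, E) x with hφ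
  set ψ := extChartAt 𝓘(ℝ, E') (f x) with hψ
  -- F is f read in charts. Near φ x it relates the chart expressions of the fields, which reduces
  -- the claim to vector spaces.
  set F : E → E' := fun y => ψ (f (φ.symm y)) with hF
  have hx : φ.symm (φ x) = x := extChartAt_to_inv x
  have hFx : F (φ x) = ψ (f x) := by simp only [hF, hx]
  have htgt : ∀ᶠ y in 𝓝 (φ x), y ∈ φ.target := extChartAt_target_mem_nhds x
  have hsrc : ∀ᶠ y in 𝓝 (φ x), f (φ.symm y) ∈ ψ.source := by
    have hc : ContinuousAt (fun y => f (φ.symm y)) (φ x) :=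
      (hf.continuous.continuousAt).comp (continuousAt_extChartAt_symm x)
    refine hc.eventually ?_
    simp only [hx]
    exact extChartAt_source_mem_nhds (f x)
  have hdsymm : ∀ {y}, y ∈ φ.target → ContMDiffAt 𝓘(ℝ, E) 𝓘(ℝ, E) ∞ φ.symm y := fun {y} hy =>
    (contMDiffOn_extChartAt_symm x).contMDiffAt
      ((isOpen_extChartAt_target x).mem_nhds hy)
  have hdψ : ∀ {z}, z ∈ ψ.source → ContMDiffAt 𝓘(ℝ, E') 𝓘(ℝ, E') ∞ ψ z := fun {z} hz =>
    contMDiffAt_extChartAt' (by simpa [hψ] using hz)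
  have hmder : ∀ {y}, y ∈ φ.target → f (φ.symm y) ∈ ψ.source → ∀ v : E, fderiv ℝ F y v
      = mder (E := E') (E' := E') ψ (f (φ.symm y)) (mder (E := E) (E' := E') f (φ.symm y)
          (mder (E := E) (E' := E) φ.symm y v)) := by
    intro y hy hz v
    have h1 := (hdsymm hy).mdifferentiableAt (by simp)
    have h2 := hf.mdifferentiable (by simp) (φ.symm y)
    have h3 := (hdψ hz).mdifferentiableAt (by simp)
    have e1 := mder_comp (h3 : MDifferentiableAt 𝓘(ℝ, E') 𝓘(ℝ, E') ψ (f (φ.symm y)))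
      (h2.comp y h1) rfl v
    have e2 := mder_comp h2 h1 rfl v
    rw [← e2]
    refine Eq.trans ?_ e1
    change _ = (mfderiv 𝓘(ℝ, E) 𝓘(ℝ, E') F y : E →L[ℝ] E') v
    rw [mfderiv_eq_fderiv]
    rfl
  have hrel : ∀ {V : (x : M) → TangentSpace 𝓘(ℝ, E) x} {W : (x : N) → TangentSpace 𝓘(ℝ, E') x},
      (∀ z, mder (E := E) (E' := E') f z (V z) = W (f z)) →
      ∀ᶠ y in 𝓝 (φ x), fderiv ℝ F y (chartField V x y) = chartField W (f x) (F y) := by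
    intro V W hVW
    filter_upwards [htgt, hsrc] with y hy hz
    rw [hmder hy hz, mder_symm_chartField V hy]
    refine (congrArg _ (hVW _)).trans ?_
    exact (chartField_extChartAt W hz).symm
  have hFd : ContDiffAt ℝ 2 F (φ x) := by
    have hm : ContMDiffAt 𝓘(ℝ, E) 𝓘(ℝ, E') ∞ F (φ x) := by
      refine ContMDiffAt.comp (I' := 𝓘(ℝ, E')) (φ x) (hdψ hsrc.self_of_nhds) ?_
      exact ContMDiffAt.comp (I' := 𝓘(ℝ, E)) (φ x) hf.contMDiffAt (hdsymm htgt.self_of_nhds)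
    exact hm.contDiffAt.of_le (by norm_cast)
  have key := fderiv_lieBracket_of_related hFd (differentiableAt_chartField hV)
    (differentiableAt_chartField hV') (hFx ▸ differentiableAt_chartField hW)
    (hFx ▸ differentiableAt_chartField hW') (hrel h) (hrel h')
  rw [hmder htgt.self_of_nhds hsrc.self_of_nhds, ← mlieBracket_eq_mder_symm] at key
  simp only [hx] at key
  rw [mlieBracket_eq_mder_symm W, ← hψ, ← hFx, ← key, hFx]
  exact (mder_extChartAt_symm_mder (E := E') (mem_extChartAt_source (I := 𝓘(ℝ, E')) (f x)) _).symm

end Related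

/-! ### Leibniz rule for finite sums -/

section Leibniz

variable {E : Type*} [NormedAddCommGroup E] [NormedSpace ℝ E] [CompleteSpace E]
  {M : Type*} [TopologicalSpace M] [ChartedSpace E M] [IsManifold 𝓘(ℝ, E) ∞ M]

lemma mlieBracket_sum_smul_right {ι : Type*} (s : Finset ι) (V : (m : M) → TangentSpace 𝓘(ℝ, E) m)
    {f : ι → M → ℝ} {X : ι → (m : M) → TangentSpace 𝓘(ℝ, E) m} {m : M}
    (hf : ∀ i, MDifferentiableAt 𝓘(ℝ, E) 𝓘(ℝ, ℝ) (f i) m)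
    (hX : ∀ i, MDifferentiableAt 𝓘(ℝ, E) (𝓘(ℝ, E).prod 𝓘(ℝ, E))
      (fun n => (⟨n, X i n⟩ : TangentBundle 𝓘(ℝ, E) M)) m) :
    mlieBracket 𝓘(ℝ, E) V (fun n => ∑ i ∈ s, f i n • X i n) m
      = ∑ i ∈ s, (mder (E := E) (E' := ℝ) (f i) m (V m) • X i m
        + f i m • mlieBracket 𝓘(ℝ, E) V (X i) m) := by
  classical
  induction s using Finset.induction_on with
  | empty =>
    simp only [Finset.sum_empty]
    exact congrFun (mlieBracket_zero_right (I := 𝓘(ℝ, E)) (W := V)) m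
  | insert i s hi ih =>
    rw [Finset.sum_insert hi, ← ih]
    simp only [Finset.sum_insert hi]
    have h1 : MDifferentiableAt 𝓘(ℝ, E) (𝓘(ℝ, E).prod 𝓘(ℝ, E))
      (fun n => (⟨n, (f i • X i) n⟩ : TangentBundle 𝓘(ℝ, E) M)) m := (hf i).smul_section (hX i)
    have h2 : MDifferentiableAt 𝓘(ℝ, E) (𝓘(ℝ, E).prod 𝓘(ℝ, E))
      (fun n => (⟨n, ∑ i ∈ s, (f i • X i) n⟩ : TangentBundle 𝓘(ℝ, E) M)) m :=
      MDifferentiableAt.sum_section fun j _ => (hf j).smul_section (hX j)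
    have h := mlieBracket_add_right (V := V) h1 h2
    rw [mlieBracket_smul_right (hf i) (hX i)] at h
    exact h

end Leibniz

/-! ### Generating vector fields and their brackets -/

section Generator

variable {𝔤 : Type*} [NormedAddCommGroup 𝔤] [NormedSpace ℝ 𝔤] [FiniteDimensional ℝ 𝔤]
  {G : Type*} [TopologicalSpace G] [ChartedSpace 𝔤 G] [Group G] [LieGroup 𝓘(ℝ, 𝔤) ∞ G]
  {E : Type*} [NormedAddCommGroup E] [NormedSpace ℝ E]
  {M : Type*} [TopologicalSpace M] [ChartedSpace E M] [IsManifold 𝓘(ℝ, E) ∞ M]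
  [MulAction G M] [ContMDiffSMul 𝓘(ℝ, 𝔤) 𝓘(ℝ, E) ∞ G M]

variable (G M) in
omit [FiniteDimensional ℝ 𝔤] in
-- The field is m ↦ ((1, x), (m, 0)) followed by the tangent map of (a, m) ↦ a⁻¹ • m.
lemma contMDiff_generator_const (x : 𝔤) :
    ContMDiff 𝓘(ℝ, E) (𝓘(ℝ, E).prod 𝓘(ℝ, E)) ∞
      (fun m : M => (⟨m, generator G m x⟩ : TangentBundle 𝓘(ℝ, E) M)) := by
  have hact : ContMDiff (𝓘(ℝ, 𝔤).prod 𝓘(ℝ, E)) 𝓘(ℝ, E) ∞ (fun p : G × M => p.1⁻¹ • p.2) :=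
    (ContMDiffSMul.contMDiff_smul (I := 𝓘(ℝ, 𝔤)) (I' := 𝓘(ℝ, E)) (n := ∞) (G := G) (M := M)).comp
      (((contMDiff_inv 𝓘(ℝ, 𝔤) ∞).comp contMDiff_fst).prodMk contMDiff_snd)
  let F₁ : M → TangentBundle 𝓘(ℝ, 𝔤) G × TangentBundle 𝓘(ℝ, E) M :=
    fun m => (⟨1, x⟩, ⟨m, 0⟩)
  have S₁ : ContMDiff 𝓘(ℝ, E) ((𝓘(ℝ, 𝔤).prod 𝓘(ℝ, 𝔤)).prod (𝓘(ℝ, E).prod 𝓘(ℝ, E))) ∞ F₁ :=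
    contMDiff_const.prodMk (Bundle.contMDiff_zeroSection _ _)
  have S₂ : ContMDiff ((𝓘(ℝ, 𝔤).prod 𝓘(ℝ, 𝔤)).prod (𝓘(ℝ, E).prod 𝓘(ℝ, E)))
      ((𝓘(ℝ, 𝔤).prod 𝓘(ℝ, E)).prod 𝓘(ℝ, 𝔤 × E)) ∞
      (equivTangentBundleProd 𝓘(ℝ, 𝔤) G 𝓘(ℝ, E) M).symm := contMDiff_equivTangentBundleProd_symm
  have S₃ : ContMDiff ((𝓘(ℝ, 𝔤).prod 𝓘(ℝ, E)).prod 𝓘(ℝ, 𝔤 × E)) (𝓘(ℝ, E).prod 𝓘(ℝ, E)) ∞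
      (tangentMap (𝓘(ℝ, 𝔤).prod 𝓘(ℝ, E)) 𝓘(ℝ, E) (fun p : G × M => p.1⁻¹ • p.2)) :=
    hact.contMDiff_tangentMap (m := ∞) (by simp)
  convert (S₃.comp S₂).comp S₁ using 1
  funext m
  have key : (mfderiv (𝓘(ℝ, 𝔤).prod 𝓘(ℝ, E)) 𝓘(ℝ, E) (fun p : G × M => p.1⁻¹ • p.2) ((1 : G), m)
      : 𝔤 × E →L[ℝ] E) (x, 0) = generator (E := E) G m x := by
    refine (mfderiv_prod_eq_add_apply (hact.mdifferentiable (by simp) _)).trans ?_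
    change mder (E := 𝔤) (E' := E) (fun a : G => a⁻¹ • m) 1 x
      + mder (E := E) (E' := E) (fun n : M => (1 : G)⁻¹ • n) m 0 = _
    rw [map_zero, add_zero]
    rfl
  have e : ∀ n : M, n = m → ∀ v w : E, v = w → (⟨m, w⟩ : TangentBundle 𝓘(ℝ, E) M) = ⟨n, v⟩ := by
    rintro _ rfl _ _ rfl; rfl
  exact e ((1 : G)⁻¹ • m) (by simp) _ _ key

omit [LieGroup 𝓘(ℝ, 𝔤) ∞ G] [IsManifold 𝓘(ℝ, E) ∞ M] [ContMDiffSMul 𝓘(ℝ, 𝔤) 𝓘(ℝ, E) ∞ G M] in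
lemma generator_eq_sum (f : M → 𝔤) (m : M) :
    generator (E := E) G m (f m) = ∑ i, (Module.finBasis ℝ 𝔤).coord i (f m)
      • generator (E := E) G m (Module.finBasis ℝ 𝔤 i) := by
  conv_lhs => rw [← (Module.finBasis ℝ 𝔤).sum_repr (f m)]
  rw [map_sum]
  simp only [map_smul, Module.Basis.coord_apply]

omit [IsManifold 𝓘(ℝ, E) ∞ M] in
lemma contMDiff_coord {f : M → 𝔤} (hf : ContMDiff 𝓘(ℝ, E) 𝓘(ℝ, 𝔤) ∞ f)
    (i : Fin (Module.finrank ℝ 𝔤)) :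
    ContMDiff 𝓘(ℝ, E) 𝓘(ℝ, ℝ) ∞ fun m => (Module.finBasis ℝ 𝔤).coord i (f m) :=
  (LinearMap.toContinuousLinearMap ((Module.finBasis ℝ 𝔤).coord i)).contMDiff.comp hf

/-- The vector field defined by a smooth section of the action algebroid is smooth. -/
lemma contMDiff_actAnchor {f : M → 𝔤} (hf : ContMDiff 𝓘(ℝ, E) 𝓘(ℝ, 𝔤) ∞ f) :
    ContMDiff 𝓘(ℝ, E) (𝓘(ℝ, E).prod 𝓘(ℝ, E)) ∞
      (fun m : M => (⟨m, actAnchor G f m⟩ : TangentBundle 𝓘(ℝ, E) M)) := by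
  have h : ContMDiff 𝓘(ℝ, E) (𝓘(ℝ, E).prod 𝓘(ℝ, E)) ∞ (fun m : M =>
      (⟨m, ∑ i, ((fun n => (Module.finBasis ℝ 𝔤).coord i (f n)) •
        fun n => generator (E := E) G n (Module.finBasis ℝ 𝔤 i)) m⟩ : TangentBundle 𝓘(ℝ, E) M)) :=
    ContMDiff.sum_section fun i _ =>
      (contMDiff_coord hf i).smul_section (contMDiff_generator_const G M _)
  convert h using 2 with m
  exact congrArg (fun v => (⟨m, v⟩ : TangentBundle 𝓘(ℝ, E) M)) (generator_eq_sum f m)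

variable [FiniteDimensional ℝ E]

/-- Expanding h in a basis of 𝔤 separates the derivative of h from the bracket with the field whose
coefficient is frozen at h(m). -/
lemma mlieBracket_actAnchor_right (V : (m : M) → TangentSpace 𝓘(ℝ, E) m) {h : M → 𝔤}
    (hh : ContMDiff 𝓘(ℝ, E) 𝓘(ℝ, 𝔤) ∞ h) (m : M) :
    mlieBracket 𝓘(ℝ, E) V (actAnchor G h) m = generator G m (dirDeriv V h m)
      + mlieBracket 𝓘(ℝ, E) V (fun n => generator G n (h m)) m := by
  have : CompleteSpace E := FiniteDimensional.complete ℝ E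
  have key : ∀ {k : M → 𝔤}, ContMDiff 𝓘(ℝ, E) 𝓘(ℝ, 𝔤) ∞ k →
      mlieBracket 𝓘(ℝ, E) V (actAnchor G k) m = generator G m (dirDeriv V k m)
        + ∑ i, (Module.finBasis ℝ 𝔤).coord i (k m)
          • mlieBracket 𝓘(ℝ, E) V (fun n => generator G n (Module.finBasis ℝ 𝔤 i)) m := by
    intro k hk
    have e : actAnchor (E := E) G k = fun n => ∑ i, (Module.finBasis ℝ 𝔤).coord i (k n)
        • generator (E := E) G n (Module.finBasis ℝ 𝔤 i) := funext (generator_eq_sum k)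
    rw [e, mlieBracket_sum_smul_right _ V
        (fun i => (contMDiff_coord hk i).mdifferentiable (by simp) m)
        (fun i => (contMDiff_generator_const G M _).mdifferentiable (by simp) m),
      Finset.sum_add_distrib, generator_eq_sum (fun _ => dirDeriv V k m) m]
    congr 1
    refine Finset.sum_congr rfl fun i _ => ?_
    congr 1
    let c := LinearMap.toContinuousLinearMap ((Module.finBasis ℝ 𝔤).coord i)
    have hc : mder (E := 𝔤) (E' := ℝ) c (k m) = c := mfderiv_eq_fderiv.trans c.fderiv
    have hcd : MDifferentiableAt 𝓘(ℝ, 𝔤) 𝓘(ℝ, ℝ) c (k m) := c.differentiableAt.mdifferentiableAt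
    refine (mder_comp hcd (hk.mdifferentiable (by simp) m) rfl _).trans ?_
    rw [hc]
    rfl
  -- For the constant function h(m) the derivative term vanishes and the same sum remains, which
  -- identifies that sum.
  have h2 := key (k := fun _ => h m) contMDiff_const
  have h3 : dirDeriv V (fun _ : M => h m) m = 0 := mder_const (E := E) (E' := 𝔤) m (h m) (V m)
  rw [h3, map_zero, zero_add] at h2
  rw [key hh, ← h2]
  rfl

/-- The generating vector fields define a Lie algebra homomorphism. -/
lemma mlieBracket_generator (x y : 𝔤) (m : M) :
    mlieBracket 𝓘(ℝ, E) (fun n => generator G n x) (fun n => generator G n y) m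
      = generator G m (lie G x y) := by
  have : LieGroup 𝓘(ℝ, 𝔤) (minSmoothness ℝ 3) G := by
    rw [minSmoothness_of_isRCLikeNormedField]; infer_instance
  have : CompleteSpace E := FiniteDimensional.complete ℝ E
  have : CompleteSpace 𝔤 := FiniteDimensional.complete ℝ 𝔤
  -- The identity (ab)⁻¹ • m = b⁻¹ • (a⁻¹ • m) relates left-invariant fields to generating fields.
  -- At a = 1 the bracket of the former is `lie G x y` by definition.
  have hrel : ∀ (x : 𝔤) (a : G), mder (E := 𝔤) (E' := E) (fun a : G => a⁻¹ • m) a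
      (mulInvariantVectorField (I := 𝓘(ℝ, 𝔤)) (G := G) x a) = generator (E := E) G (a⁻¹ • m) x := by
    intro x a
    have h := mder_comp (mdifferentiableAt_inv_smul_left (𝔤 := 𝔤) (E := E) m a)
      (mdifferentiableAt_mul_left' (𝔤 := 𝔤) a 1) (mul_one a) x
    refine h.symm.trans ?_
    have e : (fun b : G => (a * b)⁻¹ • m) = fun b => b⁻¹ • a⁻¹ • m := by
      ext b; rw [mul_inv_rev, mul_smul]
    rw [e]
    rfl
  exact (mder_mlieBracket_of_related (E := 𝔤) (E' := E)
    (contMDiff_inv_smul_left (𝔤 := 𝔤) (E := E) m)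
    (x := (1 : G)) (y := m) (by simp) (mdifferentiableAt_mulInvariantVectorField (I := 𝓘(ℝ, 𝔤)) x)
    (mdifferentiableAt_mulInvariantVectorField (I := 𝓘(ℝ, 𝔤)) y)
    ((contMDiff_generator_const G M x).mdifferentiable (by simp) m)
    ((contMDiff_generator_const G M y).mdifferentiable (by simp) m) (hrel x) (hrel y)).symm

/-- The anchor of the action algebroid is compatible with brackets. -/
lemma mlieBracket_actAnchor {f h : M → 𝔤} (hf : ContMDiff 𝓘(ℝ, E) 𝓘(ℝ, 𝔤) ∞ f)
    (hh : ContMDiff 𝓘(ℝ, E) 𝓘(ℝ, 𝔤) ∞ h) (m : M) :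
    mlieBracket 𝓘(ℝ, E) (actAnchor G f) (actAnchor G h) m
      = actAnchor G (actBracket G E f h) m := by
  -- The one-sided rule is used for h, then for f after swapping the arguments. Swapping back leaves
  -- the bracket of two constant generators.
  rw [mlieBracket_actAnchor_right _ hh, mlieBracket_swap_apply,
    mlieBracket_actAnchor_right _ hf, neg_add, ← mlieBracket_swap_apply, mlieBracket_generator]
  have e : dirDeriv (fun n => generator (E := E) G n (h m)) f m
      = dirDeriv (actAnchor (E := E) G h) f m := rfl
  rw [e, ← map_neg, ← map_add, ← map_add]
  refine congrArg (generator G m) ?_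
  rw [actBracket]
  abel

end Generator

/-! ### The action algebroid inside the pull-back algebroid -/

section ActionAlgebroid

variable {𝔤 : Type*} [NormedAddCommGroup 𝔤] [NormedSpace ℝ 𝔤] [FiniteDimensional ℝ 𝔤]
  {G : Type*} [TopologicalSpace G] [ChartedSpace 𝔤 G] [Group G] [LieGroup 𝓘(ℝ, 𝔤) ∞ G]
  {E : Type*} [NormedAddCommGroup E] [NormedSpace ℝ E] [FiniteDimensional ℝ E]
  {M : Type*} [TopologicalSpace M] [ChartedSpace E M] [IsManifold 𝓘(ℝ, E) ∞ M]
  [MulAction G M] [ContMDiffSMul 𝓘(ℝ, 𝔤) 𝓘(ℝ, E) ∞ G M]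

/-- The embedding of the action algebroid is compatible with brackets. -/
lemma bracketAM_actEmb {f h : M → 𝔤} (hf : ContMDiff 𝓘(ℝ, E) 𝓘(ℝ, 𝔤) ∞ f)
    (hh : ContMDiff 𝓘(ℝ, E) 𝓘(ℝ, 𝔤) ∞ h) :
    bracketAM G (actEmb G E f) (actEmb G E h) = actEmb G E (actBracket G E f h) := by
  funext m
  refine Prod.ext (mlieBracket_actAnchor hf hh m) ?_
  funext t
  have hneg : ∀ {k : M → 𝔤}, ContMDiff 𝓘(ℝ, E) 𝓘(ℝ, 𝔤) ∞ k →
      ∀ X : (m : M) → TangentSpace 𝓘(ℝ, E) m,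
      dirDeriv X (fun n => -k n) m = -dirDeriv X k m := by
    intro k hk X
    have := DFunLike.congr_fun (hk.mdifferentiable (by simp) m).hasMFDerivAt.neg.mfderiv (X m)
    exact this
  obtain ⟨L, hL⟩ := lie_eq (𝔤 := 𝔤) G
  -- The path components are constant in t. In -[-f, -h] the inner signs cancel, so all three terms
  -- carry the sign of x_A = -x.
  change -lie G (-f m) (-h m) + dirDeriv (actAnchor (E := E) G f) (fun n => -h n) m
    - dirDeriv (actAnchor (E := E) G h) (fun n => -f n) m = -(actBracket G E f h m)
  rw [hneg hf, hneg hh, actBracket, hL, hL]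
  simp only [map_neg, LinearMap.neg_apply, neg_neg]
  abel

omit [FiniteDimensional ℝ E] in
lemma isSectionAM_actEmb {Φ : M → G} (hΦ : ContMDiff 𝓘(ℝ, E) 𝓘(ℝ, 𝔤) ∞ Φ)
    (hΦeq : ∀ (a : G) (m : M), Φ (a • m) = a * Φ m * a⁻¹) {f : M → 𝔤}
    (hf : ContMDiff 𝓘(ℝ, E) 𝓘(ℝ, 𝔤) ∞ f) : IsSectionAM Φ (actEmb G E f) :=
  ⟨fun m => genM_mem_AM hΦ hΦeq m (f m), contMDiff_actAnchor hf,
    (hf.comp contMDiff_fst).neg⟩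

end ActionAlgebroid

end PathAlgebroid

theorem mainTheorem7
    {𝔤 : Type*} [NormedAddCommGroup 𝔤] [NormedSpace ℝ 𝔤] [FiniteDimensional ℝ 𝔤]
    {G : Type*} [TopologicalSpace G] [ChartedSpace 𝔤 G] [Group G] [LieGroup 𝓘(ℝ, 𝔤) ∞ G]
    {E : Type*} [NormedAddCommGroup E] [NormedSpace ℝ E] [FiniteDimensional ℝ E]
    {M : Type*} [TopologicalSpace M] [ChartedSpace E M] [IsManifold 𝓘(ℝ, E) ∞ M]
    [MulAction G M] [ContMDiffSMul 𝓘(ℝ, 𝔤) 𝓘(ℝ, E) ∞ G M]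
    (B : LinearMap.BilinForm ℝ 𝔤) (hBsymm : B.IsSymm) (hBnondeg : B.Nondegenerate)
    (hBinv : AdInvariant G B)
    (Φ : M → G) (hΦ : ContMDiff 𝓘(ℝ, E) 𝓘(ℝ, 𝔤) ∞ Φ)
    (hΦeq : ∀ (a : G) (m : M), Φ (a • m) = a * Φ m * a⁻¹)
    (σ : DForm E M 2) (hσ : SmoothForm σ) (hσinv : InvariantForm G σ)
    (hdσ : equivD (𝔤 := 𝔤) G σ = -equivPullback (𝔤 := 𝔤) Φ (cartanFormG (G := G) B)) :
    (∀ m : M, Function.Injective (splitMap (𝔤 := 𝔤) Φ σ m) ∧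
      LinearMap.range (splitMap (𝔤 := 𝔤) Φ σ m) = kernelM B Φ σ m) ∧
    ((∀ m : M, kerInter (𝔤 := 𝔤) Φ σ m = ⊥) →
      (∀ m : M, Function.Injective (genM G m : 𝔤 →ₗ[ℝ] TangentSpace 𝓘(ℝ, E) m × (ℝ → 𝔤)) ∧
        LinearMap.range (genM G m) = kernelM B Φ σ m) ∧
      (∀ s : Fam 𝔤 E M, (IsSectionAM Φ s ∧ ∀ m, s m ∈ kernelM B Φ σ m) ↔
        ∃ f : M → 𝔤, ContMDiff 𝓘(ℝ, E) 𝓘(ℝ, 𝔤) ∞ f ∧ s = actEmb G E f) ∧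
      (∀ f : M → 𝔤, ContMDiff 𝓘(ℝ, E) 𝓘(ℝ, 𝔤) ∞ f →
        ∀ m, (actEmb G E f m).1 = actAnchor G f m) ∧
      (∀ f h : M → 𝔤, ContMDiff 𝓘(ℝ, E) 𝓘(ℝ, 𝔤) ∞ f → ContMDiff 𝓘(ℝ, E) 𝓘(ℝ, 𝔤) ∞ h →
        bracketAM G (actEmb G E f) (actEmb G E h) = actEmb G E (actBracket G E f h))) := by
  refine ⟨fun m => ⟨injective_splitMap m, range_splitMap hBsymm hBnondeg hBinv hΦ hΦeq hdσ m⟩,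
    fun hker => ⟨fun m => ⟨injective_genM m,
      range_genM hBsymm hBnondeg hBinv hΦ hΦeq hdσ (hker m)⟩, fun s => ⟨?_, ?_⟩,
      fun _ _ _ => rfl, fun _ _ hf hh => bracketAM_actEmb hf hh⟩⟩
  · rintro ⟨⟨-, -, hs⟩, hk⟩
    -- The coefficient is recovered from the constant path at t = 0. It is smooth as a restriction
    -- of ξ to the slice M × {0}.
    refine ⟨fun m => -(s m).2 0, ?_, funext fun m => ?_⟩
    · have hi : ContMDiff 𝓘(ℝ, E) (𝓘(ℝ, E).prod 𝓘(ℝ, ℝ)) ∞ fun m : M => (m, (0 : ℝ)) :=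
        contMDiff_id.prodMk contMDiff_const
      exact (hs.comp hi).neg
    · have h := hk m
      rw [← range_genM hBsymm hBnondeg hBinv hΦ hΦeq hdσ (hker m)] at h
      obtain ⟨x, hx⟩ := h
      have e : -(s m).2 0 = x := by rw [← hx]; exact neg_neg x
      rw [actEmb, e, hx]
  · rintro ⟨f, hf, rfl⟩
    exact ⟨isSectionAM_actEmb hΦ hΦeq hf,
      fun m => genM_mem_kernelM hBsymm hBinv hΦ hΦeq hdσ m (f m)⟩
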